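/- Let $p$ be a prime and $n$ a natural number, let $|\cdot|_p$ be the absolute value of $\mathbb{Q}_p$, and put $\|x\|_p=\max_i|x_i|_p$ and $x\cdot\xi=\sum_i x_i\xi_i$ on $\mathbb{Q}_p^n$. Let $d^n x$ be the Haar measure of $\mathbb{Q}_p^n$ that gives $\mathbb{Z}_p^n$ measure $1$. Let $\Psi$ be the additive character $\mathbb{Q}_p\to\mathbb{Q}_p/\mathbb{Z}_p\hookrightarrow\mathbb{Q}/\mathbb{Z}\to\mathbb{C}^\times$, $b\mapsto e^{2\pi i b}$, and put $$(\mathcal{F}\phi)(\xi)=\int_{\mathbb{Q}_p^n}\Psi(-x\cdot\xi)\,\phi(x)\,d^nx,\qquad(\mathcal{F}^{-1}g)(x)=\int_{\mathbb{Q}_p^n}\Psi(x\cdot\xi)\,g(\xi)\,d^n\xi .$$ Let $f\in\mathbb{Q}_p[\xi_1,\dots,\xi_n]$ be a quasielliptic polynomial of degree $d$ with respect to $w=(w_1,\dots,w_n)$, where the $w_i$ are positive integers. That is, $f$ is non-constant, $f(\lambda^{w_1}\xi_1,\dots,\lambda^{w_n}\xi_n)=\lambda^d f(\xi)$ for all $\lambda\in\mathbb{Q}_p^\times$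 and $\xi\in\mathbb{Q}_p^n$, and $f(\xi)=0$ if and only if $\xi=0$. Put $\Xi(\xi)=\sum_{i=1}^n|\xi_i|_p^{d/w_i}$. Let $\Phi$ be the space of the locally constant functions $\phi:\mathbb{Q}_p^n\to\mathbb{C}$ with compact support such that $(\mathcal{F}\phi)(0)=0$, with the norms $$\|\phi\|_\beta=\Big(\int_{\mathbb{Q}_p^n}\Xi(\xi)^{2\beta}\,|(\mathcal{F}\phi)(\xi)|^2\,d^n\xi\Big)^{1/2}\qquad(\beta=0,1,2,\dots).$$ Let $\widetilde H_\infty$ be the completion of $\Phi$ for this family of norms, that is, for the metric $\rho(\phi,\chi)=\max_\beta c_\beta\,\|\phi-\chi\|_\beta/(1+\|\phi-\chi\|_\beta)$, where $(c_\beta)$ is any null sequence of positive numbers. Since $\|\cdot\|_0$ is the $L^2$-norm, $\widetilde H_\infty$ maps canonically to $L^2(\mathbb{Q}_p^n)$. A function $u$ belongs to $\widetilde H_\infty$ if it is square integrable and its class is the image of an element $h$ of $\widetilde H_\infty$; that is, some sequence in $\Phi$ converges to $h$ in $\widetilde H_\infty$ and to $u$ in $L^2$. Let $\alpha>0$, and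 let $\Omega_l$ be the indicator function of $\{x\in\mathbb{Q}_p^n:\|x\|_p\le p^l\}$ for $l\in\mathbb{Z}$. Then $e^{-t|f|_p^\alpha}$ is integrable on $\mathbb{Q}_p^n$ for every $t>0$, so that the integrals below converge absolutely, and: 1. for every integer $r\ge 1$ and every $t>0$, the function $\varphi_{r,t}=\mathcal{F}^{-1}\big((1-\Omega_{-r})\,e^{-t|f|_p^\alpha}\big)$ belongs to $\widetilde H_\infty$; 2. for every $t>0$, the function $Z(\cdot,t)$, where $Z(x,t)=\int_{\mathbb{Q}_p^n}\Psi(x\cdot\xi)\,e^{-t|f(\xi)|_p^\alpha}\,d^n\xi$, belongs to $\widetilde H_\infty$. -/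

import Mathlib

open MeasureTheory Filter Topology
open scoped ENNReal

noncomputable section

namespace PadicHeat

/-! ### The space of `p`-adic vectors, with its Haar measure -/

section Measure

variable (p : ℕ) [Fact p.Prime]

instance : MeasurableSpace ℚ_[p] := borel ℚ_[p]

instance : BorelSpace ℚ_[p] := ⟨rfl⟩

/-- The ring of `p`-adic integers, as a compact subset of `ℚ_[p]` with non-empty interior. -/
def unitBall : TopologicalSpace.PositiveCompacts ℚ_[p] where
  carrier := Metric.closedBall 0 1
  isCompact' := isCompact_closedBall 0 1
  interior_nonempty' :=
    ⟨0, Metric.ball_subset_interior_closedBall (Metric.mem_ball_self one_pos)⟩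

/-- The Haar measure of `ℚ_[p]` that gives the `p`-adic integers measure `1`; it is the one that
is self-dual for the character `psi` below. On `Fin n → ℚ_[p]` the measure `volume` is then the
product measure, and the norm is `max |x i|`. -/
instance : MeasureSpace ℚ_[p] where
  volume := Measure.addHaarMeasure (unitBall p)

instance : (volume : Measure ℚ_[p]).IsAddHaarMeasure :=
  Measure.isAddHaarMeasure_addHaarMeasure (unitBall p)

end Measure

/-! ### The standard additive character and the Fourier transform -/

section Fourier

variable {p : ℕ} [Fact p.Prime]

/-- Every class of `ℚ_p / ℤ_p` has a representative `m / p ^ k`. -/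
theorem exists_fracPart (x : ℚ_[p]) :
    ∃ q : ℚ, (∃ (m : ℤ) (k : ℕ), q = m / (p : ℚ) ^ k) ∧ ‖x - (q : ℚ_[p])‖ ≤ 1 := by
  have hp0 : (p : ℚ_[p]) ≠ 0 := by exact_mod_cast (Fact.out : p.Prime).ne_zero
  have hp1 : (1 : ℝ) < p := by exact_mod_cast (Fact.out : p.Prime).one_lt
  obtain ⟨k, hk⟩ := pow_unbounded_of_one_lt ‖x‖ hp1
  have hpk : (0 : ℝ) < (p : ℝ) ^ k := by positivity
  have hy : ‖x * (p : ℚ_[p]) ^ k‖ ≤ 1 := by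
    rw [norm_mul, norm_pow, Padic.norm_p, inv_pow, ← div_eq_mul_inv, div_le_one hpk]
    exact hk.le
  have hs := (PadicInt.norm_le_pow_iff_mem_span_pow _ k).2
    (PadicInt.appr_spec k ⟨x * (p : ℚ_[p]) ^ k, hy⟩)
  generalize PadicInt.appr (⟨x * (p : ℚ_[p]) ^ k, hy⟩ : ℤ_[p]) k = a at hs
  refine ⟨(a : ℤ) / (p : ℚ) ^ k, ⟨a, k, rfl⟩, ?_⟩
  have hs' : ‖x * (p : ℚ_[p]) ^ k - a‖ ≤ ((p : ℝ) ^ k)⁻¹ := by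
    have h2 := hs
    rw [zpow_neg, zpow_natCast] at h2
    rw [PadicInt.norm_def] at h2
    exact h2
  have he : x - (((a : ℤ) / (p : ℚ) ^ k : ℚ) : ℚ_[p])
      = (x * (p : ℚ_[p]) ^ k - a) * ((p : ℚ_[p]) ^ k)⁻¹ := by
    push_cast
    field_simp
  rw [he, norm_mul, norm_inv, norm_pow, Padic.norm_p, inv_pow, inv_inv]
  calc _ ≤ ((p : ℝ) ^ k)⁻¹ * (p : ℝ) ^ k := by gcongr
    _ = 1 := inv_mul_cancel₀ hpk.ne'

/-- A rational number `m / p ^ k` that is congruent to `x` modulo `ℤ_p`. -/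
def fracPart (x : ℚ_[p]) : ℚ := (exists_fracPart x).choose

/-- The additive character `ℚ_p → ℚ_p / ℤ_p ↪ ℚ / ℤ → ℂˣ`, `b ↦ exp (2 π i b)`. -/
def psi (x : ℚ_[p]) : ℂ := Complex.exp (2 * Real.pi * Complex.I * (fracPart x : ℂ))

/-- A rational number `m / p ^ k` that lies in `ℤ_p` is an integer. -/
theorem exists_int_of_norm_le_one (q : ℚ) (h : ∃ (m : ℤ) (k : ℕ), q = m / (p : ℚ) ^ k)
    (hq : ‖(q : ℚ_[p])‖ ≤ 1) : ∃ z : ℤ, q = z := by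
  obtain ⟨m, k, rfl⟩ := h
  have hp0 : (p : ℚ) ≠ 0 := by exact_mod_cast (Fact.out : p.Prime).ne_zero
  have hp1 : (0 : ℝ) < p := by exact_mod_cast (Fact.out : p.Prime).pos
  have hpk : (0 : ℝ) < (p : ℝ) ^ k := by positivity
  have hm : ‖(m : ℚ_[p])‖ ≤ (p : ℝ) ^ (-k : ℤ) := by
    push_cast at hq
    rw [norm_div, norm_pow, Padic.norm_p, inv_pow, div_le_one (by positivity)] at hq
    simpa [zpow_neg] using hq
  obtain ⟨c, hc⟩ := (Padic.norm_int_le_pow_iff_dvd m k).1 hm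
  refine ⟨c, ?_⟩
  rw [hc]
  push_cast
  field_simp

/-- The value of `psi` does not depend on the chosen representative. -/
theorem psi_eq (x : ℚ_[p]) (q : ℚ) (h : ∃ (m : ℤ) (k : ℕ), q = m / (p : ℚ) ^ k)
    (hq : ‖x - (q : ℚ_[p])‖ ≤ 1) : psi x = Complex.exp (2 * Real.pi * Complex.I * (q : ℂ)) := by
  have hp0 : (p : ℚ) ≠ 0 := by exact_mod_cast (Fact.out : p.Prime).ne_zero
  obtain ⟨h1, h2⟩ := (exists_fracPart x).choose_spec
  have hd : ∃ (m : ℤ) (k : ℕ), fracPart x - q = m / (p : ℚ) ^ k := by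
    obtain ⟨m, k, hm⟩ := h
    obtain ⟨m', k', hm'⟩ := h1
    refine ⟨m' * p ^ k - m * p ^ k', k' + k, ?_⟩
    rw [fracPart, hm', hm]
    push_cast
    field_simp
    ring
  have hn : ‖((fracPart x - q : ℚ) : ℚ_[p])‖ ≤ 1 := by
    have he : ((fracPart x - q : ℚ) : ℚ_[p])
        = (x - (q : ℚ_[p])) - (x - ((fracPart x : ℚ) : ℚ_[p])) := by
      push_cast
      ring
    rw [he]
    rw [sub_eq_add_neg]
    refine (IsUltrametricDist.norm_add_le_max _ _).trans (max_le hq ?_)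
    rw [norm_neg]
    exact h2
  obtain ⟨z, hz⟩ := exists_int_of_norm_le_one _ hd hn
  have hx : (fracPart x : ℂ) = q + z := by
    have : fracPart x = q + z := by linarith
    rw [this]
    push_cast
    ring
  rw [psi, hx, Complex.exp_eq_exp_iff_exists_int]
  exact ⟨z, by ring⟩

theorem psi_eq_of_norm_sub_le (x y : ℚ_[p]) (h : ‖x - y‖ ≤ 1) : psi x = psi y := by
  obtain ⟨h1, h2⟩ := (exists_fracPart y).choose_spec
  refine psi_eq x (fracPart y) h1 ?_
  have he : x - ((fracPart y : ℚ) : ℚ_[p]) = (x - y) + (y - ((fracPart y : ℚ) : ℚ_[p])) := by ring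
  rw [he]
  exact (IsUltrametricDist.norm_add_le_max _ _).trans (max_le h h2)

theorem continuous_psi : Continuous (psi : ℚ_[p] → ℂ) := by
  refine IsLocallyConstant.continuous ((IsLocallyConstant.iff_eventually_eq _).2 fun x => ?_)
  filter_upwards [Metric.closedBall_mem_nhds x one_pos] with y hy
  exact psi_eq_of_norm_sub_le y x (by simpa [dist_eq_norm] using hy)

theorem norm_psi (x : ℚ_[p]) : ‖psi x‖ = 1 := by
  have : (2 * Real.pi * Complex.I * (fracPart x : ℂ))
      = ((2 * Real.pi * (fracPart x : ℝ) : ℝ) : ℂ) * Complex.I := by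
    push_cast
    ring
  rw [psi, this, Complex.norm_exp_ofReal_mul_I]

variable {n : ℕ}

/-- The Fourier transform `∫ Ψ(-x · ξ) φ(x) dx`. -/
def fourier (φ : (Fin n → ℚ_[p]) → ℂ) (ξ : Fin n → ℚ_[p]) : ℂ :=
  ∫ x : Fin n → ℚ_[p], psi (-(x ⬝ᵥ ξ)) * φ x

/-- The inverse Fourier transform `∫ Ψ(x · ξ) g(ξ) dξ`. -/
def fourierInv (g : (Fin n → ℚ_[p]) → ℂ) (x : Fin n → ℚ_[p]) : ℂ :=
  ∫ ξ : Fin n → ℚ_[p], psi (x ⬝ᵥ ξ) * g ξ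

end Fourier

/-! ### Quasielliptic polynomials -/

section Quasielliptic

variable {p : ℕ} [Fact p.Prime] {n : ℕ}

/-- `f` is a quasielliptic polynomial of degree `d` with respect to the weights `w`. -/
structure IsQuasielliptic (f : MvPolynomial (Fin n) ℚ_[p]) (w : Fin n → ℕ) (d : ℕ) : Prop where
  nonconstant : ∀ c : ℚ_[p], f ≠ MvPolynomial.C c
  weight_pos : ∀ i, 0 < w i
  homogeneous : ∀ a : ℚ_[p], a ≠ 0 → ∀ ξ : Fin n → ℚ_[p],
    MvPolynomial.eval (fun i => a ^ w i * ξ i) f = a ^ d * MvPolynomial.eval ξ f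
  eval_eq_zero_iff : ∀ ξ : Fin n → ℚ_[p], MvPolynomial.eval ξ f = 0 ↔ ξ = 0

/-- The function `Ξ(ξ) = ∑ i, |ξ i| ^ (d / w i)`. -/
def Xi (w : Fin n → ℕ) (d : ℕ) (ξ : Fin n → ℚ_[p]) : ℝ :=
  ∑ i, ‖ξ i‖ ^ ((d : ℝ) / (w i : ℝ))

end Quasielliptic

/-! ### Schwartz–Bruhat functions and the Lizorkin space of the second kind -/

section Lizorkin

variable {p : ℕ} [Fact p.Prime] {n : ℕ}

/-- Schwartz–Bruhat functions: locally constant with compact support. -/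
def IsSchwartzBruhat (φ : (Fin n → ℚ_[p]) → ℂ) : Prop :=
  IsLocallyConstant φ ∧ HasCompactSupport φ

theorem IsSchwartzBruhat.integrable {φ : (Fin n → ℚ_[p]) → ℂ} (h : IsSchwartzBruhat φ) :
    Integrable φ :=
  h.1.continuous.integrable_of_hasCompactSupport h.2

theorem continuous_kernel :
    Continuous fun q : (Fin n → ℚ_[p]) × (Fin n → ℚ_[p]) => psi (-(q.2 ⬝ᵥ q.1)) :=
  continuous_psi.comp (by unfold dotProduct; fun_prop)

theorem integrable_kernel_mul {φ : (Fin n → ℚ_[p]) → ℂ} (h : Integrable φ)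
    (ξ : Fin n → ℚ_[p]) : Integrable fun x : Fin n → ℚ_[p] => psi (-(x ⬝ᵥ ξ)) * φ x := by
  refine h.bdd_mul (c := 1) ?_ (ae_of_all _ fun x => (norm_psi _).le)
  exact (continuous_kernel.comp (by fun_prop :
    Continuous fun x : Fin n → ℚ_[p] => (ξ, x))).aestronglyMeasurable

theorem fourier_add {φ χ : (Fin n → ℚ_[p]) → ℂ} (hφ : Integrable φ) (hχ : Integrable χ) :
    fourier (φ + χ) = fourier φ + fourier χ := by
  funext ξ
  simp only [fourier, Pi.add_apply, mul_add]
  exact integral_add (integrable_kernel_mul hφ ξ) (integrable_kernel_mul hχ ξ)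

theorem fourier_smul (c : ℂ) (φ : (Fin n → ℚ_[p]) → ℂ) : fourier (c • φ) = c • fourier φ := by
  funext ξ
  simp only [fourier, Pi.smul_apply, smul_eq_mul]
  rw [← integral_const_mul]
  congr 1
  funext x
  ring

theorem stronglyMeasurable_fourier {φ : (Fin n → ℚ_[p]) → ℂ} (h : IsSchwartzBruhat φ) :
    StronglyMeasurable (fourier φ) := by
  have hc : Continuous fun q : (Fin n → ℚ_[p]) × (Fin n → ℚ_[p]) =>
      psi (-(q.2 ⬝ᵥ q.1)) * φ q.2 :=
    continuous_kernel.mul (h.1.continuous.comp continuous_snd)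
  exact hc.stronglyMeasurable.integral_prod_right (ν := volume)

variable (p n) in
/-- The Lizorkin space `Φ` of the second kind: the Schwartz–Bruhat functions whose Fourier
transform vanishes at the origin. -/
def lizorkin : Submodule ℂ ((Fin n → ℚ_[p]) → ℂ) where
  carrier := {φ | IsSchwartzBruhat φ ∧ fourier φ 0 = 0}
  zero_mem' := by
    refine ⟨⟨IsLocallyConstant.const 0, HasCompactSupport.zero⟩, ?_⟩
    simp [fourier]
  add_mem' := by
    rintro φ χ ⟨hφ, hφ0⟩ ⟨hχ, hχ0⟩
    refine ⟨⟨hφ.1.add hχ.1, hφ.2.add hχ.2⟩, ?_⟩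
    rw [fourier_add hφ.integrable hχ.integrable, Pi.add_apply, hφ0, hχ0, add_zero]
  smul_mem' := by
    rintro c φ ⟨hφ, hφ0⟩
    refine ⟨⟨hφ.1.comp (c • ·), hφ.2.smul_left (f := fun _ => c)⟩, ?_⟩
    rw [fourier_smul, Pi.smul_apply, hφ0, smul_zero]

/-- The norm `‖φ‖_β = (∫ Ξ(ξ) ^ (2 β) |(F φ)(ξ)| ^ 2 dξ) ^ (1 / 2)`, as an extended non-negative
real number. -/
def sobolevNorm (w : Fin n → ℕ) (d : ℕ) (β : ℝ) (φ : (Fin n → ℚ_[p]) → ℂ) : ℝ≥0∞ :=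
  (∫⁻ ξ : Fin n → ℚ_[p], ENNReal.ofReal (Xi w d ξ ^ (2 * β) * ‖fourier φ ξ‖ ^ 2)) ^ (1 / 2 : ℝ)

theorem Xi_nonneg (w : Fin n → ℕ) (d : ℕ) (ξ : Fin n → ℚ_[p]) : 0 ≤ Xi w d ξ :=
  Finset.sum_nonneg fun _ _ => Real.rpow_nonneg (norm_nonneg _) _

theorem sobolevNorm_eq_eLpNorm (w : Fin n → ℕ) (d : ℕ) (β : ℝ) (φ : (Fin n → ℚ_[p]) → ℂ) :
    sobolevNorm w d β φ = eLpNorm (fun ξ => ((Xi w d ξ ^ β : ℝ) : ℂ) * fourier φ ξ) 2 volume := by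
  rw [sobolevNorm, eLpNorm_eq_lintegral_rpow_enorm_toReal (by norm_num) (by norm_num)]
  simp only [ENNReal.toReal_ofNat]
  congr 2
  funext ξ
  rw [← ofReal_norm, ENNReal.ofReal_rpow_of_nonneg (norm_nonneg _) (by norm_num),
    norm_mul, Complex.norm_real, Real.norm_of_nonneg (Real.rpow_nonneg (Xi_nonneg w d ξ) _),
    Real.rpow_two, mul_pow, mul_comm 2 β, Real.rpow_mul (Xi_nonneg w d ξ), Real.rpow_two]

theorem aestronglyMeasurable_weight_mul (w : Fin n → ℕ) (d : ℕ) (β : ℝ)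
    {φ : (Fin n → ℚ_[p]) → ℂ} (h : IsSchwartzBruhat φ) :
    AEStronglyMeasurable (fun ξ => ((Xi w d ξ ^ β : ℝ) : ℂ) * fourier φ ξ) volume := by
  have hm : Measurable fun ξ : Fin n → ℚ_[p] => ((Xi w d ξ ^ β : ℝ) : ℂ) := by
    unfold Xi
    fun_prop
  exact hm.aestronglyMeasurable.mul (stronglyMeasurable_fourier h).aestronglyMeasurable

theorem sobolevNorm_add_le (w : Fin n → ℕ) (d : ℕ) (β : ℝ) {φ χ : (Fin n → ℚ_[p]) → ℂ}
    (hφ : IsSchwartzBruhat φ) (hχ : IsSchwartzBruhat χ) :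
    sobolevNorm w d β (φ + χ) ≤ sobolevNorm w d β φ + sobolevNorm w d β χ := by
  simp only [sobolevNorm_eq_eLpNorm, fourier_add hφ.integrable hχ.integrable, Pi.add_apply,
    mul_add]
  exact eLpNorm_add_le (aestronglyMeasurable_weight_mul w d β hφ)
    (aestronglyMeasurable_weight_mul w d β hχ) (by norm_num)

theorem sobolevNorm_zero (w : Fin n → ℕ) (d : ℕ) (β : ℝ) :
    sobolevNorm w d β (0 : (Fin n → ℚ_[p]) → ℂ) = 0 := by
  have : fourier (0 : (Fin n → ℚ_[p]) → ℂ) = 0 := by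
    funext ξ
    simp [fourier]
  simp [sobolevNorm, this]

theorem sobolevNorm_sub_comm (w : Fin n → ℕ) (d : ℕ) (β : ℝ) (φ χ : (Fin n → ℚ_[p]) → ℂ) :
    sobolevNorm w d β (φ - χ) = sobolevNorm w d β (χ - φ) := by
  have : fourier (φ - χ) = (-1 : ℂ) • fourier (χ - φ) := by
    rw [← fourier_smul]
    congr 1
    module
  simp [sobolevNorm, this]

/-! ### The space `H̃_∞` -/

/-- The distance `‖φ - χ‖_β` on the Lizorkin space. -/
@[reducible] def sobolevEMetric (w : Fin n → ℕ) (d : ℕ) (β : ℝ) :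
    PseudoEMetricSpace (lizorkin p n) where
  edist φ χ := sobolevNorm w d β (φ.1 - χ.1)
  edist_self φ := by rw [sub_self, sobolevNorm_zero]
  edist_comm φ χ := sobolevNorm_sub_comm w d β _ _
  edist_triangle φ χ ω := by
    have h := sobolevNorm_add_le w d β (lizorkin p n |>.sub_mem φ.2 χ.2).1
      (lizorkin p n |>.sub_mem χ.2 ω.2).1
    rwa [sub_add_sub_cancel] at h

variable (p) in
/-- The Lizorkin space `Φ`, to be equipped with the family of norms `‖ ‖_β`, `β ∈ ℕ`. -/
def LizorkinInf (_w : Fin n → ℕ) (_d : ℕ) : Type := lizorkin p n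

/-- The uniformity of the family of norms `‖ ‖_β`, `β ∈ ℕ`; it is the uniformity of each of the
metrics `max_β c_β ‖φ - χ‖_β / (1 + ‖φ - χ‖_β)`, where `c` is a null sequence of positive
numbers. -/
instance (w : Fin n → ℕ) (d : ℕ) : UniformSpace (LizorkinInf p w d) :=
  (⨅ β : ℕ, (sobolevEMetric w d (β : ℝ)).toUniformSpace : UniformSpace (lizorkin p n))

/-- The underlying function of an element of `Φ`. -/
def LizorkinInf.toFun {w : Fin n → ℕ} {d : ℕ} (φ : LizorkinInf p w d) : (Fin n → ℚ_[p]) → ℂ :=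
  Subtype.val (p := fun φ => φ ∈ lizorkin p n) φ

variable (p) in
/-- The space `H̃_∞`: the completion of `Φ` for the family of norms `‖ ‖_β`, `β ∈ ℕ`. -/
abbrev HTildeInf (w : Fin n → ℕ) (d : ℕ) : Type :=
  UniformSpace.Completion (LizorkinInf p w d)

/-- The function `u` belongs to `H̃_∞`: it is square integrable, and there are an element `h` of
`H̃_∞` and a sequence in `Φ` that converges to `h` in `H̃_∞` and to `u` in `L²` (that is, `u` is
the function which the canonical map from the completion to `L²` attaches to `h`; recall that
`‖ ‖_0` is the `L²`-norm). -/
def MemHTildeInf (w : Fin n → ℕ) (d : ℕ) (u : (Fin n → ℚ_[p]) → ℂ) : Prop :=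
  MemLp u 2 volume ∧ ∃ (h : HTildeInf p w d) (φ : ℕ → LizorkinInf p w d),
    Tendsto (fun l => (φ l : HTildeInf p w d)) atTop (𝓝 h) ∧
    Tendsto (fun l => eLpNorm ((φ l).toFun - u) 2 volume) atTop (𝓝 0)

end Lizorkin

/-! ### The functions of the theorem -/

section Heat

variable {p : ℕ} [Fact p.Prime] {n : ℕ}

open scoped Classical in
/-- The indicator function `Ω_l` of the ball `‖x‖ ≤ p ^ l`. -/
def Omega (l : ℤ) (x : Fin n → ℚ_[p]) : ℂ := if ‖x‖ ≤ (p : ℝ) ^ l then 1 else 0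

/-- The function `exp (-t |f(ξ)| ^ α)`. -/
def heatSymbol (f : MvPolynomial (Fin n) ℚ_[p]) (α t : ℝ) (ξ : Fin n → ℚ_[p]) : ℂ :=
  (Real.exp (-t * ‖MvPolynomial.eval ξ f‖ ^ α) : ℂ)

/-- The function `φ_{r,t} = F⁻¹((1 - Ω_{-r}) exp (-t |f| ^ α))`. -/
def phi (f : MvPolynomial (Fin n) ℚ_[p]) (α : ℝ) (r : ℕ) (t : ℝ) : (Fin n → ℚ_[p]) → ℂ :=
  fourierInv fun ξ => (1 - Omega (-(r : ℤ)) ξ) * heatSymbol f α t ξ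

/-- The heat kernel `Z(x, t) = ∫ Ψ(x · ξ) exp (-t |f(ξ)| ^ α) dξ`. -/
def heatKernel (f : MvPolynomial (Fin n) ℚ_[p]) (α : ℝ) (x : Fin n → ℚ_[p]) (t : ℝ) : ℂ :=
  ∫ ξ : Fin n → ℚ_[p], psi (x ⬝ᵥ ξ) * heatSymbol f α t ξ

end Heat

end PadicHeat

end

/-!
All the functions in question have the form `F⁻¹ g`, where `g` is rapidly decreasing and locally
constant away from the origin, and every such function belongs to `H̃_∞`
(`RapidlyDecreasing.memHTildeInf_fourierInv`).

To see this, let `G l` be the restriction of `g` to the annulus `p ^ (-l) < ‖ξ‖ ≤ p ^ l`. It is a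
Schwartz–Bruhat function that vanishes at `0`, so by Fourier inversion
(`IsSchwartzBruhat.fourier_fourierInv`) its inverse transform `φ l = F⁻¹ (G l)` lies in `Φ`, and
`F (φ l) = G l`. Since `Ξ ^ β g` is square integrable for every `β`, dominated convergence gives
`Ξ ^ β G l → Ξ ^ β g` in `L²`, hence `φ` is Cauchy for all norms `‖ ‖_β`. Moreover `φ l → F⁻¹ g`
pointwise since `g` is integrable, and the Plancherel identity for Schwartz–Bruhat functions together
with Fatou's lemma turns this into convergence in `L²`; so the Plancherel theorem for `L¹ ∩ L²` is
not needed. Inversion and Plancherel for Schwartz–Bruhat functions come from Fubini's theorem and the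
integral of the character over a ball (`integral_psi_dotProduct_closedBall`).

The symbol `exp (-t |f| ^ α)` is locally constant away from the origin because `f` has no other zero.
It decreases rapidly because `|f|` grows at least like a positive power of `‖ξ‖`
(`IsQuasielliptic.exists_lower_bound`): by quasihomogeneity every large point is scaled into a fixed
compact set that avoids the origin, where `|f|` is bounded below, and the degree is positive.
-/

namespace PadicHeat

/-! ### The character -/

section Character

variable {p : ℕ} [Fact p.Prime]

theorem one_lt_natCast_prime : (1 : ℝ) < p := by exact_mod_cast (Fact.out : p.Prime).one_lt

theorem psi_add (x y : ℚ_[p]) : psi (x + y) = psi x * psi y := by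
  have hp0 : (p : ℚ) ≠ 0 := by exact_mod_cast (Fact.out : p.Prime).ne_zero
  obtain ⟨⟨m, k, h1⟩, h2⟩ := (exists_fracPart x).choose_spec
  obtain ⟨⟨m', k', h1'⟩, h2'⟩ := (exists_fracPart y).choose_spec
  rw [psi_eq (x + y) (fracPart x + fracPart y), psi, psi, ← Complex.exp_add]
  · push_cast
    ring_nf
  · refine ⟨m * p ^ k' + m' * p ^ k, k + k', ?_⟩
    rw [fracPart, fracPart, h1, h1']
    push_cast
    field_simp
    ring
  · have he : x + y - ((fracPart x + fracPart y : ℚ) : ℚ_[p])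
        = (x - (fracPart x : ℚ_[p])) + (y - (fracPart y : ℚ_[p])) := by
      push_cast
      ring
    rw [he]
    exact (IsUltrametricDist.norm_add_le_max _ _).trans (max_le h2 h2')

theorem psi_of_norm_le_one {x : ℚ_[p]} (h : ‖x‖ ≤ 1) : psi x = 1 := by
  rw [psi_eq x 0 ⟨0, 0, by simp⟩ (by simpa using h)]
  simp

theorem psi_neg (x : ℚ_[p]) : psi (-x) = (starRingEnd ℂ) (psi x) := by
  have h : psi (-x) * psi x = 1 := by
    rw [← psi_add, neg_add_cancel, psi_of_norm_le_one (by simp)]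
  have h0 : psi x ≠ 0 := fun h0 => by simp [h0] at h
  apply mul_right_cancel₀ h0
  rw [h, mul_comm, Complex.mul_conj, Complex.normSq_eq_norm_sq, norm_psi]
  simp

/-- The character is non-trivial on every fractional ideal `x ℤ_p` that is not contained in
`ℤ_p`. -/
theorem exists_psi_mul_ne_one {x : ℚ_[p]} (h : 1 < ‖x‖) :
    ∃ y : ℚ_[p], ‖y‖ ≤ 1 ∧ psi (x * y) ≠ 1 := by
  have hp : p.Prime := Fact.out
  have hp0 : (p : ℚ_[p]) ≠ 0 := by exact_mod_cast hp.ne_zero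
  have hp1 : (1 : ℝ) < p := one_lt_natCast_prime
  have hx : x ≠ 0 := fun h0 => by simp [h0] at h; linarith
  have hpx : (p : ℝ) ≤ ‖x‖ := by
    have := (Padic.norm_lt_pow_iff_norm_le_pow_sub_one x 1).not
    simp only [zpow_one, sub_self, zpow_zero, not_lt, not_le] at this
    exact this.2 h
  -- For this `y`, the product `x * y` is `1 / p`, where the character is a primitive `p`-th root
  -- of unity.
  refine ⟨(p * x)⁻¹, ?_, ?_⟩
  · rw [norm_inv, norm_mul, Padic.norm_p, mul_inv, inv_inv, ← div_eq_mul_inv]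
    exact div_le_one_of_le₀ hpx (norm_nonneg _)
  · have he : x * (p * x)⁻¹ = ((1 / (p : ℚ) ^ 1 : ℚ) : ℚ_[p]) := by
      push_cast
      field_simp
    rw [psi_eq _ (1 / (p : ℚ) ^ 1) ⟨1, 1, by simp⟩ (by rw [he]; simp)]
    rw [Ne, Complex.exp_eq_one_iff]
    rintro ⟨m, hm⟩
    have h2 : (2 * Real.pi * Complex.I : ℂ) ≠ 0 := Complex.two_pi_I_ne_zero
    rw [mul_comm (m : ℂ)] at hm
    have h3 := mul_left_cancel₀ h2 hm
    have hpc : (p : ℂ) ≠ 0 := by exact_mod_cast hp.ne_zero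
    push_cast at h3
    rw [pow_one, div_eq_iff hpc] at h3
    have h4 : (1 : ℤ) = m * p := by exact_mod_cast h3
    have h5 : (p : ℤ) ∣ 1 := ⟨m, by rw [h4, mul_comm]⟩
    have h6 : p ∣ 1 := by exact_mod_cast h5
    exact hp.one_lt.ne' (Nat.dvd_one.1 h6)

end Character

/-! ### Volumes of balls -/

section Balls

variable {p : ℕ} [Fact p.Prime]

/-- A ball is covered by the `p` residue classes of its rescaling to `ℤ_p`. -/
theorem closedBall_zpow_succ_eq_iUnion (k : ℤ) :
    Metric.closedBall (0 : ℚ_[p]) ((p : ℝ) ^ (k + 1))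
      = ⋃ a : Fin p, Metric.closedBall ((a : ℕ) * (p : ℚ_[p]) ^ (-(k + 1))) ((p : ℝ) ^ k) := by
  have hp0 : (p : ℚ_[p]) ≠ 0 := by exact_mod_cast (Fact.out : p.Prime).ne_zero
  have hp1 : (1 : ℝ) < p := one_lt_natCast_prime
  have hpos : (0 : ℝ) < p := by linarith
  ext x
  simp only [Metric.mem_closedBall, dist_eq_norm, sub_zero, Set.mem_iUnion]
  constructor
  · intro hx
    have hy : ‖x * (p : ℚ_[p]) ^ (k + 1)‖ ≤ 1 := by
      rw [norm_mul, Padic.norm_p_zpow, zpow_neg, ← div_eq_mul_inv]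
      exact (div_le_one (by positivity)).2 hx
    set y : ℤ_[p] := ⟨x * (p : ℚ_[p]) ^ (k + 1), hy⟩ with hydef
    refine ⟨⟨y.zmodRepr, PadicInt.zmodRepr_lt_p y⟩, ?_⟩
    have h1 := PadicInt.norm_sub_zmodRepr_lt_one y
    rw [PadicInt.norm_def] at h1
    push_cast at h1
    have h2 : ‖(y : ℚ_[p]) - (y.zmodRepr : ℚ_[p])‖ ≤ (p : ℝ) ^ (-1 : ℤ) := by
      rw [Padic.norm_le_pow_iff_norm_lt_pow_add_one]
      simpa using h1
    have he : x - (y.zmodRepr : ℚ_[p]) * (p : ℚ_[p]) ^ (-(k + 1))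
        = ((y : ℚ_[p]) - (y.zmodRepr : ℚ_[p])) * (p : ℚ_[p]) ^ (-(k + 1)) := by
      rw [sub_mul, hydef]
      simp only
      rw [mul_assoc, ← zpow_add₀ hp0]
      simp
    rw [he, norm_mul, Padic.norm_p_zpow]
    calc _ ≤ (p : ℝ) ^ (-1 : ℤ) * (p : ℝ) ^ (-(-(k + 1))) := by gcongr
      _ = _ := by
        rw [← zpow_add₀ hpos.ne']
        congr 1
        ring
  · rintro ⟨a, ha⟩
    have he : x = (x - (a : ℕ) * (p : ℚ_[p]) ^ (-(k + 1)))
        + (a : ℕ) * (p : ℚ_[p]) ^ (-(k + 1)) := by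
      ring
    rw [he]
    refine (IsUltrametricDist.norm_add_le_max _ _).trans (max_le (ha.trans ?_) ?_)
    · exact zpow_le_zpow_right₀ hp1.le (by linarith)
    · rw [norm_mul, Padic.norm_p_zpow, neg_neg]
      have : ‖((a : ℕ) : ℚ_[p])‖ ≤ 1 := by
        simpa using Padic.norm_int_le_one (p := p) (a : ℕ)
      exact mul_le_of_le_one_left (by positivity) this

theorem volume_closedBall_center (x : ℚ_[p]) (r : ℝ) :
    volume (Metric.closedBall x r) = volume (Metric.closedBall (0 : ℚ_[p]) r) := by
  rw [← measure_preimage_add_right volume x]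
  congr 1
  ext z
  simp

theorem volume_closedBall_zpow_succ (k : ℤ) :
    volume (Metric.closedBall (0 : ℚ_[p]) ((p : ℝ) ^ (k + 1)))
      = p * volume (Metric.closedBall (0 : ℚ_[p]) ((p : ℝ) ^ k)) := by
  have hp1 : (1 : ℝ) < p := one_lt_natCast_prime
  have hpos : (0 : ℝ) < p := by linarith
  rw [closedBall_zpow_succ_eq_iUnion, measure_iUnion]
  · simp [volume_closedBall_center]
  · intro a b hab
    rw [Function.onFun, Set.disjoint_left]
    intro x hxa hxb
    rw [Metric.mem_closedBall, dist_eq_norm] at hxa hxb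
    apply hab
    have h1 : ‖(((a : ℕ) : ℤ) - ((b : ℕ) : ℤ) : ℚ_[p]) * (p : ℚ_[p]) ^ (-(k + 1))‖
        ≤ (p : ℝ) ^ k := by
      have he : (((a : ℕ) : ℤ) - ((b : ℕ) : ℤ) : ℚ_[p]) * (p : ℚ_[p]) ^ (-(k + 1))
          = (x - (b : ℕ) * (p : ℚ_[p]) ^ (-(k + 1)))
            - (x - (a : ℕ) * (p : ℚ_[p]) ^ (-(k + 1))) := by
        push_cast
        ring
      rw [he, sub_eq_add_neg]
      exact (IsUltrametricDist.norm_add_le_max _ _).trans (max_le hxb ((norm_neg _).trans_le hxa))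
    rw [norm_mul, Padic.norm_p_zpow, neg_neg] at h1
    have h2 : ‖(((a : ℕ) - (b : ℕ) : ℤ) : ℚ_[p])‖ < 1 := by
      push_cast
      push_cast at h1
      by_contra hlt
      push Not at hlt
      have h3 : (p : ℝ) ^ (k + 1) ≤ (p : ℝ) ^ k :=
        (le_mul_of_one_le_left (by positivity) hlt).trans h1
      exact absurd h3 (not_le.2 (zpow_lt_zpow_right₀ hp1 (by linarith)))
    rw [Padic.norm_intCast_lt_one_iff] at h2
    have h4 := Int.eq_zero_of_abs_lt_dvd h2 (by
      have := a.2; have := b.2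
      rw [abs_lt]; constructor <;> omega)
    ext
    omega
  · exact fun a => Metric.isClosed_closedBall.measurableSet

theorem volume_closedBall_zpow (k : ℤ) :
    volume (Metric.closedBall (0 : ℚ_[p]) ((p : ℝ) ^ k)) = ENNReal.ofReal ((p : ℝ) ^ k) := by
  have hp1 : (1 : ℝ) < p := one_lt_natCast_prime
  have hpos : (0 : ℝ) < p := by linarith
  have hs (j : ℤ) : ENNReal.ofReal ((p : ℝ) ^ (j + 1)) = p * ENNReal.ofReal ((p : ℝ) ^ j) := by
    rw [zpow_add₀ hpos.ne', zpow_one, mul_comm, ENNReal.ofReal_mul hpos.le, ENNReal.ofReal_natCast]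
  have h0 : (p : ℝ≥0∞) ≠ 0 := by exact_mod_cast (Fact.out : p.Prime).ne_zero
  have ht : (p : ℝ≥0∞) ≠ ∞ := ENNReal.natCast_ne_top p
  induction k using Int.induction_on with
  | zero =>
    simp only [zpow_zero, ENNReal.ofReal_one]
    exact Measure.addHaarMeasure_self (K₀ := unitBall p)
  | succ i ih => rw [volume_closedBall_zpow_succ, ih, hs]
  | pred i ih =>
    have h1 := volume_closedBall_zpow_succ (p := p) (-(i : ℤ) - 1)
    have h2 := hs (-(i : ℤ) - 1)
    rw [sub_add_cancel] at h1 h2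
    rw [h1, h2] at ih
    exact (ENNReal.mul_right_inj h0 ht).1 ih

variable {n : ℕ}

theorem volume_pi_closedBall_zpow (x : Fin n → ℚ_[p]) (k : ℤ) :
    volume (Metric.closedBall x ((p : ℝ) ^ k)) = ENNReal.ofReal (((p : ℝ) ^ k) ^ n) := by
  have hpos : (0 : ℝ) < p := by linarith [one_lt_natCast_prime (p := p)]
  rw [volume_pi_closedBall _ (by positivity)]
  simp [volume_closedBall_center, volume_closedBall_zpow, ENNReal.ofReal_pow (zpow_nonneg hpos.le k)]

end Balls

/-! ### Fourier inversion and the Plancherel identity for Schwartz–Bruhat functions -/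

section Inversion

variable {p : ℕ} [Fact p.Prime] {n : ℕ}

theorem norm_dotProduct_le (x ξ : Fin n → ℚ_[p]) : ‖x ⬝ᵥ ξ‖ ≤ ‖x‖ * ‖ξ‖ := by
  refine IsUltrametricDist.norm_sum_le_of_forall_le_of_nonneg (by positivity) fun i _ => ?_
  rw [norm_mul]
  exact mul_le_mul (norm_le_pi_norm x i) (norm_le_pi_norm ξ i) (norm_nonneg _) (norm_nonneg _)

theorem psi_dotProduct_eq_one {x ξ : Fin n → ℚ_[p]} {k : ℤ} (hx : ‖x‖ ≤ (p : ℝ) ^ k)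
    (hξ : ‖ξ‖ ≤ (p : ℝ) ^ (-k)) : psi (x ⬝ᵥ ξ) = 1 := by
  have hpos : (0 : ℝ) < p := by linarith [one_lt_natCast_prime (p := p)]
  refine psi_of_norm_le_one ((norm_dotProduct_le x ξ).trans ?_)
  calc ‖x‖ * ‖ξ‖ ≤ (p : ℝ) ^ k * (p : ℝ) ^ (-k) := by gcongr
    _ = 1 := by rw [← zpow_add₀ hpos.ne', add_neg_cancel, zpow_zero]

/-- Together with `psi_dotProduct_eq_one`: the annihilator of the ball of radius `p ^ k` for the
pairing `psi (x ⬝ᵥ ξ)` is the ball of radius `p ^ (-k)`. -/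
theorem exists_psi_dotProduct_ne_one {ξ : Fin n → ℚ_[p]} {k : ℤ} (hξ : ¬‖ξ‖ ≤ (p : ℝ) ^ (-k)) :
    ∃ a : Fin n → ℚ_[p], ‖a‖ ≤ (p : ℝ) ^ k ∧ psi (a ⬝ᵥ ξ) ≠ 1 := by
  have hpos : (0 : ℝ) < p := by linarith [one_lt_natCast_prime (p := p)]
  rw [pi_norm_le_iff_of_nonneg (by positivity)] at hξ
  push Not at hξ
  obtain ⟨i, hi⟩ := hξ
  have h1 : 1 < ‖ξ i * (p : ℚ_[p]) ^ (-k)‖ := by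
    rw [norm_mul, Padic.norm_p_zpow, neg_neg]
    calc (1 : ℝ) = (p : ℝ) ^ (-k) * (p : ℝ) ^ k := by
          rw [← zpow_add₀ hpos.ne', neg_add_cancel, zpow_zero]
      _ < _ := by gcongr
  obtain ⟨y, hy, hpsi⟩ := exists_psi_mul_ne_one h1
  refine ⟨Pi.single i ((p : ℚ_[p]) ^ (-k) * y), ?_, ?_⟩
  · rw [Pi.norm_single, norm_mul, Padic.norm_p_zpow, neg_neg]
    exact mul_le_of_le_one_right (by positivity) hy
  · rw [single_dotProduct]
    convert hpsi using 2
    ring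

theorem continuous_psi_dotProduct (x : Fin n → ℚ_[p]) :
    Continuous fun ξ : Fin n → ℚ_[p] => psi (x ⬝ᵥ ξ) :=
  continuous_psi.comp (by unfold dotProduct; fun_prop)

theorem norm_add_le_iff_of_norm_le {a : Fin n → ℚ_[p]} {r : ℝ} (ha : ‖a‖ ≤ r)
    (x : Fin n → ℚ_[p]) : ‖x + a‖ ≤ r ↔ ‖x‖ ≤ r := by
  constructor <;> intro h
  · have he : x = (x + a) + -a := by abel
    rw [he]
    exact (IsUltrametricDist.norm_add_le_max _ _).trans (max_le h ((norm_neg a).trans_le ha))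
  · exact (IsUltrametricDist.norm_add_le_max _ _).trans (max_le h ha)

open scoped Classical in
/-- Orthogonality of characters on the compact group `{x | ‖x‖ ≤ p ^ k}`. -/
theorem integral_psi_dotProduct_closedBall (k : ℤ) (ξ : Fin n → ℚ_[p]) :
    ∫ x in Metric.closedBall (0 : Fin n → ℚ_[p]) ((p : ℝ) ^ k), psi (x ⬝ᵥ ξ)
      = if ‖ξ‖ ≤ (p : ℝ) ^ (-k) then ((((p : ℝ) ^ k) ^ n : ℝ) : ℂ) else 0 := by
  have hpos : (0 : ℝ) < p := by linarith [one_lt_natCast_prime (p := p)]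
  have hm : MeasurableSet (Metric.closedBall (0 : Fin n → ℚ_[p]) ((p : ℝ) ^ k)) :=
    Metric.isClosed_closedBall.measurableSet
  split_ifs with h
  · rw [setIntegral_congr_fun (g := fun _ => (1 : ℂ)) hm fun x hx =>
      psi_dotProduct_eq_one (by simpa using hx) h]
    rw [setIntegral_const, measureReal_def, volume_pi_closedBall_zpow,
      ENNReal.toReal_ofReal (by positivity)]
    simp
  · -- Translation by `a` preserves the ball and multiplies the integral by `psi (a ⬝ᵥ ξ) ≠ 1`.
    obtain ⟨a, ha, hne⟩ := exists_psi_dotProduct_ne_one h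
    have h1 : ∫ x in Metric.closedBall (0 : Fin n → ℚ_[p]) ((p : ℝ) ^ k), psi (x ⬝ᵥ ξ)
        = (∫ x in Metric.closedBall (0 : Fin n → ℚ_[p]) ((p : ℝ) ^ k), psi (x ⬝ᵥ ξ))
          * psi (a ⬝ᵥ ξ) := by
      rw [← integral_indicator hm, ← integral_mul_const,
        ← integral_add_right_eq_self _ a]
      congr 1
      funext x
      simp only [Set.indicator_apply, mem_closedBall_zero_iff,
        norm_add_le_iff_of_norm_le ha]
      split_ifs
      · rw [add_dotProduct, psi_add]
      · simp
    have h2 : (∫ x in Metric.closedBall (0 : Fin n → ℚ_[p]) ((p : ℝ) ^ k), psi (x ⬝ᵥ ξ))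
        * (psi (a ⬝ᵥ ξ) - 1) = 0 := by
      rw [mul_sub, ← h1, mul_one, sub_self]
    exact (mul_eq_zero.1 h2).resolve_right (sub_ne_zero.2 hne)

/-- A Schwartz–Bruhat function is supported in a ball and invariant under translation by the elements
of a ball; one exponent `k` serves both purposes. -/
theorem IsSchwartzBruhat.exists_radius {g : (Fin n → ℚ_[p]) → ℂ} (hg : IsSchwartzBruhat g) :
    ∃ k : ℤ, (∀ ξ, g ξ ≠ 0 → ‖ξ‖ ≤ (p : ℝ) ^ k) ∧
      ∀ ξ η, ‖η‖ ≤ (p : ℝ) ^ (-k) → g (ξ + η) = g ξ := by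
  have hp1 : (1 : ℝ) < p := one_lt_natCast_prime
  have hpos : (0 : ℝ) < p := by linarith
  obtain ⟨δ, hδ, hball⟩ := lebesgue_number_lemma_of_metric hg.2.isCompact
    (c := fun c : ℂ => g ⁻¹' {c}) (fun c => hg.1 {c}) (fun x _ => by simp)
  have hball' : ∀ x ∈ tsupport g, ∀ y, ‖y - x‖ < δ → g y = g x := by
    intro x hx y hy
    obtain ⟨c, hc⟩ := hball x hx
    rw [show g y = c from hc (by rwa [Metric.mem_ball, dist_eq_norm]),
      show g x = c from hc (Metric.mem_ball_self hδ)]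
  obtain ⟨R, hR⟩ := hg.2.isCompact.isBounded.exists_norm_le
  obtain ⟨a, ha⟩ := pow_unbounded_of_one_lt R hp1
  obtain ⟨b, hb⟩ := pow_unbounded_of_one_lt δ⁻¹ hp1
  refine ⟨(max a b : ℕ), fun ξ hξ => ?_, fun ξ η hη => ?_⟩
  · rw [zpow_natCast]
    exact ((hR ξ (subset_tsupport _ hξ)).trans ha.le).trans
      (pow_le_pow_right₀ hp1.le (le_max_left a b))
  · have hη' : ‖η‖ < δ := by
      refine hη.trans_lt ?_
      rw [zpow_neg, zpow_natCast]
      refine inv_lt_of_inv_lt₀ hδ (hb.trans_le (pow_le_pow_right₀ hp1.le (le_max_right a b)))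
    by_cases h1 : ξ ∈ tsupport g
    · exact hball' ξ h1 _ (by simpa using hη')
    by_cases h2 : ξ + η ∈ tsupport g
    · exact (hball' _ h2 ξ (by simpa using hη')).symm
    · rw [image_eq_zero_of_notMem_tsupport h1, image_eq_zero_of_notMem_tsupport h2]

theorem isSchwartzBruhat_of_radius {g : (Fin n → ℚ_[p]) → ℂ} {k l : ℤ}
    (hs : ∀ ξ, g ξ ≠ 0 → ‖ξ‖ ≤ (p : ℝ) ^ k)
    (hl : ∀ ξ η, ‖η‖ ≤ (p : ℝ) ^ l → g (ξ + η) = g ξ) : IsSchwartzBruhat g := by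
  have hpos : (0 : ℝ) < p := by linarith [one_lt_natCast_prime (p := p)]
  refine ⟨(IsLocallyConstant.iff_eventually_eq _).2 fun x => ?_, ?_⟩
  · filter_upwards [Metric.closedBall_mem_nhds x (by positivity : 0 < (p : ℝ) ^ l)] with y hy
    rw [← hl x (y - x) (by rwa [Metric.mem_closedBall, dist_eq_norm] at hy), add_sub_cancel]
  · refine HasCompactSupport.intro (isCompact_closedBall (0 : Fin n → ℚ_[p]) ((p : ℝ) ^ k)) ?_
    intro x hx
    by_contra hne
    exact hx (by simpa using hs x hne)

/-- The inverse transform of a function with bounded support is invariant under small translations. -/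
theorem fourierInv_add_eq {g : (Fin n → ℚ_[p]) → ℂ} {k : ℤ}
    (hs : ∀ ξ, g ξ ≠ 0 → ‖ξ‖ ≤ (p : ℝ) ^ k) (x y : Fin n → ℚ_[p]) (hy : ‖y‖ ≤ (p : ℝ) ^ (-k)) :
    fourierInv g (x + y) = fourierInv g x := by
  unfold fourierInv
  congr 1
  funext ξ
  by_cases h : g ξ = 0
  · simp [h]
  · rw [add_dotProduct, psi_add, psi_dotProduct_eq_one hy (by simpa using hs ξ h), mul_one]

/-- The inverse transform of a function that is invariant under small translations has bounded
support: translation of `g` by `a` multiplies the transform by the character of `a`. -/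
theorem norm_le_of_fourierInv_ne_zero {g : (Fin n → ℚ_[p]) → ℂ} {k : ℤ}
    (hl : ∀ ξ η, ‖η‖ ≤ (p : ℝ) ^ (-k) → g (ξ + η) = g ξ) (x : Fin n → ℚ_[p])
    (hx : fourierInv g x ≠ 0) : ‖x‖ ≤ (p : ℝ) ^ k := by
  by_contra h
  obtain ⟨a, ha, hne⟩ := exists_psi_dotProduct_ne_one (k := -k) (by rwa [neg_neg])
  have h1 : fourierInv g x = psi (a ⬝ᵥ x) * fourierInv g x := by
    conv_lhs => rw [fourierInv, ← integral_add_right_eq_self _ a]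
    rw [fourierInv, ← integral_const_mul]
    congr 1
    funext ξ
    rw [hl ξ a ha, dotProduct_add, psi_add, dotProduct_comm x a]
    ring
  have h2 : (psi (a ⬝ᵥ x) - 1) * fourierInv g x = 0 := by
    rw [sub_mul, ← h1, one_mul, sub_self]
  exact hx ((mul_eq_zero.1 h2).resolve_left (sub_ne_zero.2 hne))

theorem IsSchwartzBruhat.fourierInv {g : (Fin n → ℚ_[p]) → ℂ} (hg : IsSchwartzBruhat g) :
    IsSchwartzBruhat (fourierInv g) := by
  obtain ⟨k, hs, hl⟩ := hg.exists_radius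
  exact isSchwartzBruhat_of_radius (norm_le_of_fourierInv_ne_zero hl) (fourierInv_add_eq hs)

/-- Fourier inversion. The integral over `x` may be restricted to a large ball, which makes Fubini's
theorem applicable; the integral of the character over that ball is a multiple of the indicator
function of the dual ball, on which `g (ξ₀ + ·)` is constant. -/
theorem IsSchwartzBruhat.fourier_fourierInv {g : (Fin n → ℚ_[p]) → ℂ} (hg : IsSchwartzBruhat g) :
    fourier (PadicHeat.fourierInv g) = g := by
  classical
  have hpos : (0 : ℝ) < p := by linarith [one_lt_natCast_prime (p := p)]
  obtain ⟨k, hs, hl⟩ := hg.exists_radius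
  funext ξ₀
  set B := Metric.closedBall (0 : Fin n → ℚ_[p]) ((p : ℝ) ^ k) with hB
  have hm : MeasurableSet B := Metric.isClosed_closedBall.measurableSet
  have hfin : IsFiniteMeasure (volume.restrict B) :=
    ⟨by simpa using (isCompact_closedBall (0 : Fin n → ℚ_[p]) ((p : ℝ) ^ k)).measure_lt_top⟩
  have h1 : fourier (PadicHeat.fourierInv g) ξ₀
      = ∫ x in B, psi (-(x ⬝ᵥ ξ₀)) * PadicHeat.fourierInv g x := by
    rw [fourier, setIntegral_eq_integral_of_forall_compl_eq_zero]
    intro x hx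
    rw [not_imp_comm.1 (norm_le_of_fourierInv_ne_zero hl x) (by simpa [hB] using hx), mul_zero]
  have hint : Integrable (fun q : (Fin n → ℚ_[p]) × (Fin n → ℚ_[p]) =>
      psi (q.1 ⬝ᵥ (q.2 - ξ₀)) * g q.2) ((volume.restrict B).prod volume) := by
    refine (hg.integrable.comp_snd (volume.restrict B)).bdd_mul (c := 1) ?_
      (ae_of_all _ fun x => (norm_psi _).le)
    exact (continuous_psi.comp (by unfold dotProduct; fun_prop)).aestronglyMeasurable
  have h2 : ∀ x : Fin n → ℚ_[p], psi (-(x ⬝ᵥ ξ₀)) * PadicHeat.fourierInv g x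
      = ∫ ξ, psi (x ⬝ᵥ (ξ - ξ₀)) * g ξ := by
    intro x
    rw [PadicHeat.fourierInv, ← integral_const_mul]
    congr 1
    funext ξ
    rw [sub_eq_add_neg, dotProduct_add, psi_add, dotProduct_neg]
    ring
  simp only [h1, h2]
  rw [integral_integral_swap hint]
  have h3 : ∀ ξ : Fin n → ℚ_[p], ∫ x in B, psi (x ⬝ᵥ (ξ - ξ₀)) * g ξ
      = (Metric.closedBall ξ₀ ((p : ℝ) ^ (-k))).indicator
        (fun _ => ((((p : ℝ) ^ k) ^ n : ℝ) : ℂ) * g ξ₀) ξ := by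
    intro ξ
    rw [integral_mul_const, integral_psi_dotProduct_closedBall, Set.indicator_apply]
    simp only [Metric.mem_closedBall, dist_eq_norm]
    split_ifs with h
    · rw [← hl ξ₀ (ξ - ξ₀) h, add_sub_cancel]
    · rw [zero_mul]
  simp only [h3]
  rw [integral_indicator Metric.isClosed_closedBall.measurableSet, setIntegral_const,
    measureReal_def, volume_pi_closedBall_zpow, ENNReal.toReal_ofReal (by positivity)]
  rw [Complex.real_smul, ← mul_assoc, ← Complex.ofReal_mul, ← mul_pow, ← zpow_add₀ hpos.ne']
  simp

theorem IsSchwartzBruhat.memLp_two {g : (Fin n → ℚ_[p]) → ℂ} (hg : IsSchwartzBruhat g) :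
    MemLp g 2 volume :=
  hg.1.continuous.memLp_of_hasCompactSupport hg.2

/-- Both sides are equal to the integral of `psi (-(x ⬝ᵥ ξ)) φ(x) conj (g ξ)` over all `x` and `ξ`,
where `φ = fourierInv g`, in the two orders of integration. -/
theorem IsSchwartzBruhat.integral_norm_sq_fourierInv {g : (Fin n → ℚ_[p]) → ℂ}
    (hg : IsSchwartzBruhat g) :
    ∫ x, ‖PadicHeat.fourierInv g x‖ ^ 2 = ∫ ξ, ‖g ξ‖ ^ 2 := by
  have hφ := hg.fourierInv
  set φ := PadicHeat.fourierInv g with hφd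
  have hsq (z : ℂ) : ((‖z‖ ^ 2 : ℝ) : ℂ) = z * (starRingEnd ℂ) z := by
    rw [Complex.mul_conj, Complex.normSq_eq_norm_sq]
  have hconj : Integrable fun ξ => (starRingEnd ℂ) (g ξ) :=
    (Complex.conjLIE.integrable_comp_iff (φ := g)).2 hg.integrable
  have hint : Integrable (fun q : (Fin n → ℚ_[p]) × (Fin n → ℚ_[p]) =>
      psi (-(q.1 ⬝ᵥ q.2)) * (φ q.1 * (starRingEnd ℂ) (g q.2))) (volume.prod volume) := by
    refine (hφ.integrable.mul_prod hconj).bdd_mul (c := 1) ?_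
      (ae_of_all _ fun x => (norm_psi _).le)
    exact (continuous_psi.comp (by unfold dotProduct; fun_prop)).aestronglyMeasurable
  have hL : ∀ x, ((‖φ x‖ ^ 2 : ℝ) : ℂ)
      = ∫ ξ, psi (-(x ⬝ᵥ ξ)) * (φ x * (starRingEnd ℂ) (g ξ)) := by
    intro x
    rw [hsq]
    nth_rewrite 2 [hφd]
    rw [PadicHeat.fourierInv, ← integral_conj, ← integral_const_mul]
    congr 1
    funext ξ
    rw [map_mul, psi_neg]
    ring
  have hR : ∀ ξ, ((‖g ξ‖ ^ 2 : ℝ) : ℂ)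
      = ∫ x, psi (-(x ⬝ᵥ ξ)) * (φ x * (starRingEnd ℂ) (g ξ)) := by
    intro ξ
    rw [hsq]
    nth_rewrite 1 [← hg.fourier_fourierInv]
    rw [fourier, ← integral_mul_const]
    congr 1
    funext x
    ring
  have : ((∫ x, ‖φ x‖ ^ 2 : ℝ) : ℂ) = ((∫ ξ, ‖g ξ‖ ^ 2 : ℝ) : ℂ) := by
    rw [← integral_complex_ofReal, ← integral_complex_ofReal]
    simp only [hL, hR]
    exact integral_integral_swap hint
  exact_mod_cast this

/-- The Plancherel identity. -/
theorem IsSchwartzBruhat.eLpNorm_fourierInv {g : (Fin n → ℚ_[p]) → ℂ} (hg : IsSchwartzBruhat g) :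
    eLpNorm (PadicHeat.fourierInv g) 2 volume = eLpNorm g 2 volume := by
  rw [hg.fourierInv.memLp_two.eLpNorm_eq_integral_rpow_norm (by norm_num) (by norm_num),
    hg.memLp_two.eLpNorm_eq_integral_rpow_norm (by norm_num) (by norm_num)]
  simp only [ENNReal.toReal_ofNat, Real.rpow_two, hg.integral_norm_sq_fourierInv]

end Inversion

/-! ### Rapidly decreasing functions -/

section RapidDecay

variable {p : ℕ} [Fact p.Prime] {n : ℕ}

/-- The function decreases at infinity faster than every power of the norm. No regularity is
required. -/
def RapidlyDecreasing (g : (Fin n → ℚ_[p]) → ℂ) : Prop :=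
  ∀ N : ℕ, ∃ C : ℝ, ∀ ξ, (1 + ‖ξ‖) ^ N * ‖g ξ‖ ≤ C

theorem RapidlyDecreasing.mono {g h : (Fin n → ℚ_[p]) → ℂ} (hg : RapidlyDecreasing g)
    (hh : ∀ ξ, ‖h ξ‖ ≤ ‖g ξ‖) : RapidlyDecreasing h := by
  intro N
  obtain ⟨C, hC⟩ := hg N
  exact ⟨C, fun ξ => (mul_le_mul_of_nonneg_left (hh ξ) (by positivity)).trans (hC ξ)⟩

/-- Sum over the balls of radius `p ^ l`: a point of norm about `p ^ l` contributes to the `l`-th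
summand, which is the volume `p ^ (l n)` of the ball times `p ^ (-l (n + 1))`. -/
theorem integrable_inv_one_add_norm_pow :
    Integrable fun ξ : Fin n → ℚ_[p] => ((1 + ‖ξ‖) ^ (n + 1))⁻¹ := by
  have hp1 : (1 : ℝ) < p := one_lt_natCast_prime
  have hpos : (0 : ℝ) < p := by linarith
  have hcont : Continuous fun ξ : Fin n → ℚ_[p] => ((1 + ‖ξ‖) ^ (n + 1))⁻¹ :=
    Continuous.inv₀ (by fun_prop) fun ξ => by positivity
  refine ⟨hcont.aestronglyMeasurable, ?_⟩
  rw [hasFiniteIntegral_iff_ofReal (ae_of_all _ fun ξ => by positivity)]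
  set a : ℕ → ℝ := fun l => (p : ℝ) ^ (n + 1) * (((p : ℝ) ^ l) ^ (n + 1))⁻¹ with ha
  have hm (l : ℕ) : MeasurableSet (Metric.closedBall (0 : Fin n → ℚ_[p]) ((p : ℝ) ^ (l : ℤ))) :=
    Metric.isClosed_closedBall.measurableSet
  have hle : ∀ ξ : Fin n → ℚ_[p], ENNReal.ofReal ((1 + ‖ξ‖) ^ (n + 1))⁻¹
      ≤ ∑' l : ℕ, (Metric.closedBall (0 : Fin n → ℚ_[p]) ((p : ℝ) ^ (l : ℤ))).indicator
        (fun _ => ENNReal.ofReal (a l)) ξ := by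
    intro ξ
    classical
    have hex : ∃ l : ℕ, ‖ξ‖ ≤ (p : ℝ) ^ l :=
      (pow_unbounded_of_one_lt ‖ξ‖ hp1).imp fun _ h => h.le
    set l := Nat.find hex with hl
    refine le_trans ?_ (ENNReal.le_tsum l)
    rw [Set.indicator_of_mem (by simpa using Nat.find_spec hex)]
    refine ENNReal.ofReal_le_ofReal ?_
    -- By minimality of `l`, the norm exceeds `p ^ (l - 1)` unless `l = 0`.
    have hlow : (p : ℝ) ^ l ≤ p * (1 + ‖ξ‖) := by
      rcases Nat.eq_zero_or_pos l with h0 | h0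
      · rw [h0, pow_zero]
        nlinarith [norm_nonneg ξ]
      · have h1 := Nat.find_min hex (Nat.sub_lt h0 one_pos)
        push Not at h1
        obtain ⟨m, hm⟩ := Nat.exists_eq_succ_of_ne_zero h0.ne'
        rw [← hl, hm, Nat.succ_sub_one] at h1
        rw [hm, pow_succ']
        gcongr
        linarith
    rw [ha]
    simp only
    rw [← div_eq_mul_inv, ← div_pow, ← inv_pow]
    refine pow_le_pow_left₀ (by positivity) ?_ _
    rw [inv_le_iff_one_le_mul₀ (by positivity), div_mul_eq_mul_div, le_div_iff₀ (by positivity),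
      one_mul]
    exact hlow
  refine (lintegral_mono hle).trans_lt ?_
  rw [lintegral_tsum fun l => (measurable_const.indicator (hm l)).aemeasurable]
  have hterm (l : ℕ) : ∫⁻ ξ, (Metric.closedBall (0 : Fin n → ℚ_[p]) ((p : ℝ) ^ (l : ℤ))).indicator
      (fun _ => ENNReal.ofReal (a l)) ξ = ENNReal.ofReal ((p : ℝ) ^ (n + 1) * ((p : ℝ)⁻¹) ^ l) := by
    rw [lintegral_indicator_const (hm l), volume_pi_closedBall_zpow,
      ← ENNReal.ofReal_mul (by positivity)]
    congr 1
    rw [ha]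
    simp only [zpow_natCast]
    rw [pow_succ ((p : ℝ) ^ l) n, inv_pow]
    field_simp
  simp only [hterm]
  refine Ne.lt_top (Summable.tsum_ofReal_ne_top (Summable.mul_left _ ?_))
  exact summable_geometric_of_lt_one (by positivity) (inv_lt_one_of_one_lt₀ hp1)

theorem RapidlyDecreasing.integrable {g : (Fin n → ℚ_[p]) → ℂ} (hg : RapidlyDecreasing g)
    (hm : AEStronglyMeasurable g volume) : Integrable g := by
  obtain ⟨C, hC⟩ := hg (n + 1)
  refine (integrable_inv_one_add_norm_pow.const_mul C).mono' hm (ae_of_all _ fun ξ => ?_)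
  rw [← div_eq_mul_inv, le_div_iff₀ (by positivity), mul_comm]
  exact hC ξ

theorem RapidlyDecreasing.mul {g h : (Fin n → ℚ_[p]) → ℂ} (hg : RapidlyDecreasing g) {m : ℕ}
    {K : ℝ} (hh : ∀ ξ, ‖h ξ‖ ≤ K * (1 + ‖ξ‖) ^ m) :
    RapidlyDecreasing fun ξ => h ξ * g ξ := by
  intro N
  obtain ⟨C, hC⟩ := hg (N + m)
  have hK : 0 ≤ K := nonneg_of_mul_nonneg_left ((norm_nonneg _).trans (hh 0)) (by positivity)
  refine ⟨K * C, fun ξ => ?_⟩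
  rw [norm_mul]
  calc (1 + ‖ξ‖) ^ N * (‖h ξ‖ * ‖g ξ‖)
      ≤ (1 + ‖ξ‖) ^ N * ((K * (1 + ‖ξ‖) ^ m) * ‖g ξ‖) := by gcongr; exact hh ξ
    _ = K * ((1 + ‖ξ‖) ^ (N + m) * ‖g ξ‖) := by ring
    _ ≤ K * C := by gcongr; exact hC ξ

theorem RapidlyDecreasing.memLp_two {g : (Fin n → ℚ_[p]) → ℂ} (hg : RapidlyDecreasing g)
    (hm : AEStronglyMeasurable g volume) : MemLp g 2 volume := by
  obtain ⟨C, hC⟩ := hg 0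
  have h : Integrable fun ξ => g ξ * g ξ :=
    (hg.mul (m := 0) (K := C) (fun ξ => by simpa using hC ξ)).integrable (hm.mul hm)
  rw [memLp_two_iff_integrable_sq_norm hm]
  refine h.norm.congr (ae_of_all _ fun ξ => ?_)
  simp only [norm_mul, sq]

/-- A weight `w i = 0` does no harm, since then the exponent `d / w i` is `0`. -/
theorem Xi_le (w : Fin n → ℕ) (d : ℕ) (ξ : Fin n → ℚ_[p]) : Xi w d ξ ≤ n * (1 + ‖ξ‖) ^ d := by
  have h : ∀ i, ‖ξ i‖ ^ ((d : ℝ) / (w i : ℝ)) ≤ (1 + ‖ξ‖) ^ d := by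
    intro i
    have h1 : (d : ℝ) / (w i : ℝ) ≤ d := by
      rcases Nat.eq_zero_or_pos (w i) with h0 | h0
      · simp [h0]
      · exact div_le_self (Nat.cast_nonneg d) (by exact_mod_cast h0)
    calc ‖ξ i‖ ^ ((d : ℝ) / (w i : ℝ)) ≤ (1 + ‖ξ‖) ^ ((d : ℝ) / (w i : ℝ)) := by
          refine Real.rpow_le_rpow (norm_nonneg _) ?_ (by positivity)
          linarith [norm_le_pi_norm ξ i]
      _ ≤ (1 + ‖ξ‖) ^ (d : ℝ) := Real.rpow_le_rpow_of_exponent_le (by linarith [norm_nonneg ξ]) h1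
      _ = _ := Real.rpow_natCast _ _
  calc Xi w d ξ ≤ ∑ _i : Fin n, (1 + ‖ξ‖) ^ d := Finset.sum_le_sum fun i _ => h i
    _ = _ := by simp

theorem RapidlyDecreasing.weight_mul {g : (Fin n → ℚ_[p]) → ℂ} (hg : RapidlyDecreasing g)
    (w : Fin n → ℕ) (d β : ℕ) :
    RapidlyDecreasing fun ξ => ((Xi w d ξ ^ (β : ℝ) : ℝ) : ℂ) * g ξ := by
  refine hg.mul (m := d * β) (K := (n : ℝ) ^ β) fun ξ => ?_
  rw [Complex.norm_real, Real.rpow_natCast, Real.norm_of_nonneg (pow_nonneg (Xi_nonneg w d ξ) _),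
    pow_mul, ← mul_pow]
  exact pow_le_pow_left₀ (Xi_nonneg w d ξ) (Xi_le w d ξ) β

end RapidDecay

/-! ### Growth of quasielliptic polynomials and decay of the heat symbol -/

section Growth

variable {p : ℕ} [Fact p.Prime] {n : ℕ} {f : MvPolynomial (Fin n) ℚ_[p]} {w : Fin n → ℕ} {d : ℕ}

theorem IsQuasielliptic.dim_pos (hf : IsQuasielliptic f w d) : 0 < n := by
  rcases Nat.eq_zero_or_pos n with rfl | h
  · exact absurd (MvPolynomial.eq_C_of_isEmpty f) (hf.nonconstant _)
  · exact h

/-- In degree `0` the polynomial would be constant along the curve `(p ^ (k w i))`, which tends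
to the zero `0` of the polynomial. -/
theorem IsQuasielliptic.degree_pos (hf : IsQuasielliptic f w d) : 0 < d := by
  rcases Nat.eq_zero_or_pos d with rfl | h
  swap
  · exact h
  exfalso
  have hp0 : (p : ℚ_[p]) ≠ 0 := by exact_mod_cast (Fact.out : p.Prime).ne_zero
  have hconst (k : ℕ) : MvPolynomial.eval (fun i => ((p : ℚ_[p]) ^ k) ^ w i * 1) f
      = MvPolynomial.eval (fun _ => 1) f := by
    simpa using hf.homogeneous ((p : ℚ_[p]) ^ k) (pow_ne_zero k hp0) (fun _ => 1)
  have hlim : Tendsto (fun (k : ℕ) (i : Fin n) => ((p : ℚ_[p]) ^ k) ^ w i * 1) atTop (𝓝 0) := by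
    rw [tendsto_pi_nhds]
    intro i
    have h1 := (tendsto_pow_atTop_nhds_zero_of_norm_lt_one
      (Padic.norm_p_lt_one (p := p))).pow (w i)
    simpa [(hf.weight_pos i).ne'] using h1
  have h2 := ((MvPolynomial.continuous_eval f).tendsto 0).comp hlim
  rw [(hf.eval_eq_zero_iff 0).2 rfl] at h2
  have h3 : MvPolynomial.eval (fun _ => 1) f = 0 :=
    tendsto_nhds_unique (tendsto_const_nhds.congr fun k => (hconst k).symm) h2
  have h4 := congrFun ((hf.eval_eq_zero_iff _).1 h3) ⟨0, hf.dim_pos⟩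
  exact one_ne_zero h4

/-- A quasielliptic polynomial grows at least like a positive power of the norm: the scalings
`ξ i ↦ p ^ (j w i) ξ i` move every large point into a compact set that does not contain `0`. -/
theorem IsQuasielliptic.exists_lower_bound (hf : IsQuasielliptic f w d) :
    ∃ (c : ℝ) (W : ℕ), 0 < c ∧ ∀ ξ : Fin n → ℚ_[p], 1 < ‖ξ‖ →
      1 ≤ ‖MvPolynomial.eval ξ f‖ / c ∧ ‖ξ‖ ≤ (‖MvPolynomial.eval ξ f‖ / c) ^ W := by
  classical
  have hp1 : (1 : ℝ) < p := one_lt_natCast_prime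
  have hpos : (0 : ℝ) < p := by linarith
  have hp0 : (p : ℚ_[p]) ≠ 0 := by exact_mod_cast (Fact.out : p.Prime).ne_zero
  set W := ∑ i, w i with hW
  have hwW (i : Fin n) : w i ≤ W := Finset.single_le_sum (f := w) (fun _ _ => Nat.zero_le _)
    (Finset.mem_univ i)
  set S : Set (Fin n → ℚ_[p]) := Metric.closedBall 0 1 ∩ {η | ((p : ℝ) ^ W)⁻¹ ≤ ‖η‖} with hS
  have hScomp : IsCompact S :=
    (isCompact_closedBall _ _).inter_right (isClosed_le continuous_const continuous_norm)
  obtain ⟨c, hc, hcS⟩ := hScomp.exists_forall_le' (a := 0)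
    (f := fun η => ‖MvPolynomial.eval η f‖) (MvPolynomial.continuous_eval f).norm.continuousOn (by
      intro η hη
      rw [norm_pos_iff, Ne, hf.eval_eq_zero_iff]
      rintro rfl
      have h0 : ((p : ℝ) ^ W)⁻¹ ≤ ‖(0 : Fin n → ℚ_[p])‖ := hη.2
      rw [norm_zero] at h0
      exact absurd h0 (not_le.2 (by positivity)))
  refine ⟨c, W, hc, fun ξ hξ => ?_⟩
  have hex : ∃ j : ℕ, ∀ i, ‖ξ i‖ ≤ ((p : ℝ) ^ j) ^ w i := by
    obtain ⟨j, hj⟩ := pow_unbounded_of_one_lt ‖ξ‖ hp1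
    refine ⟨j, fun i => ((norm_le_pi_norm ξ i).trans hj.le).trans ?_⟩
    exact le_self_pow₀ (one_le_pow₀ hp1.le) (hf.weight_pos i).ne'
  -- By minimality of `j`, the rescaled point `η` below is not too small.
  set j := Nat.find hex with hj
  have hj1 : ∀ i, ‖ξ i‖ ≤ ((p : ℝ) ^ j) ^ w i := Nat.find_spec hex
  have hjpos : 0 < j := by
    rcases Nat.eq_zero_or_pos j with h0 | h0
    · rw [h0] at hj1
      exact absurd ((pi_norm_le_iff_of_nonneg zero_le_one).2 (by simpa using hj1)) (not_le.2 hξ)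
    · exact h0
  obtain ⟨m, hm⟩ := Nat.exists_eq_succ_of_ne_zero hjpos.ne'
  have hj2 := Nat.find_min hex (m := m) (by omega)
  push Not at hj2
  obtain ⟨i, hi⟩ := hj2
  set η : Fin n → ℚ_[p] := fun i => ((p : ℚ_[p]) ^ j) ^ w i * ξ i with hη
  have hηn (i : Fin n) : ‖η i‖ = (((p : ℝ) ^ j) ^ w i)⁻¹ * ‖ξ i‖ := by
    simp only [hη, norm_mul, norm_pow, Padic.norm_p, inv_pow]
  have hηS : η ∈ S := by
    constructor
    · rw [mem_closedBall_zero_iff, pi_norm_le_iff_of_nonneg zero_le_one]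
      intro i
      rw [hηn, inv_mul_le_one₀ (by positivity)]
      exact hj1 i
    · refine le_trans ?_ (norm_le_pi_norm η i)
      rw [hηn]
      calc ((p : ℝ) ^ W)⁻¹ ≤ ((p : ℝ) ^ w i)⁻¹ := by
            gcongr
            · exact hp1.le
            · exact hwW i
        _ = (((p : ℝ) ^ j) ^ w i)⁻¹ * ((p : ℝ) ^ m) ^ w i := by
            rw [hm, pow_succ, mul_pow]
            field_simp
        _ ≤ _ := by gcongr
  have hfη : c ≤ ‖MvPolynomial.eval η f‖ := hcS η hηS
  rw [hη, hf.homogeneous _ (pow_ne_zero j hp0), norm_mul, norm_pow, norm_pow, Padic.norm_p,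
    inv_pow, inv_pow, inv_mul_eq_div, le_div_iff₀ (by positivity)] at hfη
  have hge : (p : ℝ) ^ j ≤ ‖MvPolynomial.eval ξ f‖ / c := by
    rw [le_div_iff₀ hc, mul_comm]
    refine le_trans ?_ hfη
    gcongr
    exact le_self_pow₀ (one_le_pow₀ hp1.le) hf.degree_pos.ne'
  refine ⟨(one_le_pow₀ hp1.le).trans hge, le_trans ?_ (pow_le_pow_left₀ (by positivity) hge W)⟩
  rw [pi_norm_le_iff_of_nonneg (by positivity)]
  intro i
  exact (hj1 i).trans (pow_le_pow_right₀ (one_le_pow₀ hp1.le) (hwW i))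

theorem norm_heatSymbol (f : MvPolynomial (Fin n) ℚ_[p]) (α t : ℝ) (ξ : Fin n → ℚ_[p]) :
    ‖heatSymbol f α t ξ‖ = Real.exp (-(t * ‖MvPolynomial.eval ξ f‖ ^ α)) := by
  rw [heatSymbol, Complex.norm_real, Real.norm_of_nonneg (Real.exp_nonneg _), neg_mul]

theorem IsQuasielliptic.rapidlyDecreasing_heatSymbol (hf : IsQuasielliptic f w d) {α t : ℝ}
    (hα : 0 < α) (ht : 0 < t) : RapidlyDecreasing (heatSymbol f α t) := by
  intro N
  obtain ⟨c, W, hc, hb⟩ := hf.exists_lower_bound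
  -- With this `m`, the power `(y ^ α) ^ m` dominates `‖ξ‖ ^ N`, and `exp x ≥ x ^ m / m!`.
  set m := ⌈(W * N : ℕ) / α⌉₊ with hm
  have hmα : ((W * N : ℕ) : ℝ) ≤ α * m := by
    rw [← div_le_iff₀' hα]
    exact Nat.le_ceil _
  refine ⟨2 ^ N * max 1 (m.factorial / (t * c ^ α) ^ m), fun ξ => ?_⟩
  rw [norm_heatSymbol]
  set x := t * ‖MvPolynomial.eval ξ f‖ ^ α with hx
  have hx0 : 0 ≤ x := by positivity
  rcases le_or_gt ‖ξ‖ 1 with h1 | h1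
  · calc (1 + ‖ξ‖) ^ N * Real.exp (-x) ≤ 2 ^ N * 1 := by
          gcongr
          · linarith
          · exact Real.exp_le_one_iff.2 (by linarith)
      _ ≤ _ := by gcongr; exact le_max_left _ _
  · obtain ⟨hy1, hyW⟩ := hb ξ h1
    set y := ‖MvPolynomial.eval ξ f‖ / c with hy
    have hy0 : 0 < y := by linarith
    have hxy : x = (t * c ^ α) * y ^ α := by
      rw [hx, mul_assoc, ← Real.mul_rpow hc.le hy0.le, hy, mul_div_cancel₀ _ hc.ne']
    have hpow : ‖ξ‖ ^ N ≤ (y ^ α) ^ m := by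
      calc ‖ξ‖ ^ N ≤ (y ^ W) ^ N := by gcongr
        _ = y ^ ((W * N : ℕ) : ℝ) := by rw [Real.rpow_natCast, pow_mul]
        _ ≤ y ^ (α * m) := Real.rpow_le_rpow_of_exponent_le hy1 hmα
        _ = (y ^ α) ^ m := by rw [Real.rpow_mul hy0.le, Real.rpow_natCast]
    have hexp : x ^ m ≤ m.factorial * Real.exp x := by
      have := Real.pow_div_factorial_le_exp x hx0 m
      rwa [div_le_iff₀ (by positivity), mul_comm] at this
    have hmain : (y ^ α) ^ m * Real.exp (-x) ≤ m.factorial / (t * c ^ α) ^ m := by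
      rw [le_div_iff₀ (by positivity), Real.exp_neg, ← div_eq_mul_inv, div_mul_eq_mul_div,
        div_le_iff₀ (Real.exp_pos x), ← mul_pow, mul_comm (y ^ α), ← hxy]
      exact hexp
    calc (1 + ‖ξ‖) ^ N * Real.exp (-x) ≤ (2 * ‖ξ‖) ^ N * Real.exp (-x) := by
          gcongr
          linarith
      _ = 2 ^ N * (‖ξ‖ ^ N * Real.exp (-x)) := by ring
      _ ≤ 2 ^ N * ((y ^ α) ^ m * Real.exp (-x)) := by gcongr
      _ ≤ 2 ^ N * (m.factorial / (t * c ^ α) ^ m) := by gcongr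
      _ ≤ _ := by gcongr; exact le_max_right _ _

/-- The heat symbol is locally constant away from the origin, because the `p`-adic norm is locally
constant away from `0` and the polynomial has no other zero. -/
theorem IsQuasielliptic.eventually_heatSymbol_eq (hf : IsQuasielliptic f w d) (α t : ℝ)
    {ξ : Fin n → ℚ_[p]} (hξ : ξ ≠ 0) : ∀ᶠ η in 𝓝 ξ, heatSymbol f α t η = heatSymbol f α t ξ := by
  have h0 : 0 < ‖MvPolynomial.eval ξ f‖ := by
    rw [norm_pos_iff, Ne, hf.eval_eq_zero_iff]
    exact hξ
  filter_upwards [(MvPolynomial.continuous_eval f).continuousAt.eventually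
    (Metric.ball_mem_nhds _ h0)] with η hη
  rw [dist_eq_norm] at hη
  rw [heatSymbol, heatSymbol, Padic.norm_eq_of_norm_sub_lt_right hη]

end Growth

/-! ### Truncation to annuli -/

section Truncation

variable {p : ℕ} [Fact p.Prime] {n : ℕ}

variable (p n) in
/-- The annulus `p ^ (-l) < ‖ξ‖ ≤ p ^ l`, a compact open set that avoids the origin. -/
def annulus (l : ℕ) : Set (Fin n → ℚ_[p]) :=
  Metric.closedBall 0 ((p : ℝ) ^ (l : ℤ)) \ Metric.closedBall 0 ((p : ℝ) ^ (-(l : ℤ)))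

theorem isClopen_closedBall_zpow (k : ℤ) :
    IsClopen (Metric.closedBall (0 : Fin n → ℚ_[p]) ((p : ℝ) ^ k)) := by
  have hpos : (0 : ℝ) < p := by linarith [one_lt_natCast_prime (p := p)]
  exact IsUltrametricDist.isClopen_closedBall _ (zpow_pos hpos k).ne'

theorem isClopen_annulus (l : ℕ) : IsClopen (annulus p n l) :=
  (isClopen_closedBall_zpow _).diff (isClopen_closedBall_zpow _)

theorem zero_notMem_annulus (l : ℕ) : (0 : Fin n → ℚ_[p]) ∉ annulus p n l :=
  fun h => h.2 (Metric.mem_closedBall_self (by positivity))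

theorem eventually_mem_annulus {ξ : Fin n → ℚ_[p]} (hξ : ξ ≠ 0) :
    ∀ᶠ l in atTop, ξ ∈ annulus p n l := by
  have hp1 : (1 : ℝ) < p := one_lt_natCast_prime
  have h := tendsto_pow_atTop_atTop_of_one_lt hp1
  filter_upwards [h.eventually_ge_atTop ‖ξ‖, h.eventually_gt_atTop ‖ξ‖⁻¹] with l h1 h2
  refine ⟨by simpa using h1, ?_⟩
  rw [mem_closedBall_zero_iff, zpow_neg, zpow_natCast, not_le]
  exact inv_lt_of_inv_lt₀ (norm_pos_iff.2 hξ) h2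

theorem isSchwartzBruhat_indicator_annulus {g : (Fin n → ℚ_[p]) → ℂ}
    (hg : ∀ ξ ≠ 0, ∀ᶠ η in 𝓝 ξ, g η = g ξ) (l : ℕ) :
    IsSchwartzBruhat ((annulus p n l).indicator g) := by
  refine ⟨(IsLocallyConstant.iff_eventually_eq _).2 fun ξ => ?_, ?_⟩
  · by_cases hξ : ξ ∈ annulus p n l
    · have h0 : ξ ≠ 0 := fun h0 => zero_notMem_annulus l (h0 ▸ hξ)
      filter_upwards [hg ξ h0, (isClopen_annulus l).isOpen.mem_nhds hξ] with η h1 h2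
      rw [Set.indicator_of_mem h2, Set.indicator_of_mem hξ, h1]
    · filter_upwards [(isClopen_annulus l).compl.isOpen.mem_nhds hξ] with η h2
      rw [Set.indicator_of_notMem h2, Set.indicator_of_notMem hξ]
  · refine HasCompactSupport.intro
      (isCompact_closedBall (0 : Fin n → ℚ_[p]) ((p : ℝ) ^ (l : ℤ))) fun ξ hξ => ?_
    exact Set.indicator_of_notMem (fun h => hξ h.1) _

/-- In dimension `0` the origin is the whole space and has measure `1`. -/
theorem ae_ne_zero (hn : 0 < n) : ∀ᵐ ξ : Fin n → ℚ_[p], ξ ≠ 0 := by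
  have : Nonempty (Fin n) := ⟨⟨0, hn⟩⟩
  rw [ae_iff]
  simp

theorem ae_tendsto_indicator_annulus (hn : 0 < n) (g : (Fin n → ℚ_[p]) → ℂ) :
    ∀ᵐ ξ, Tendsto (fun l => (annulus p n l).indicator g ξ) atTop (𝓝 (g ξ)) := by
  filter_upwards [ae_ne_zero hn] with ξ hξ
  refine tendsto_const_nhds.congr' ?_
  filter_upwards [eventually_mem_annulus hξ] with l hl
  rw [Set.indicator_of_mem hl]

theorem tendsto_eLpNorm_indicator_annulus_sub (hn : 0 < n) {h : (Fin n → ℚ_[p]) → ℂ}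
    (hh : MemLp h 2 volume) :
    Tendsto (fun l => eLpNorm ((annulus p n l).indicator h - h) 2 volume) atTop (𝓝 0) := by
  have hsq (u : (Fin n → ℚ_[p]) → ℂ) :
      eLpNorm u 2 volume = (∫⁻ ξ, ‖u ξ‖ₑ ^ (2 : ℝ)) ^ (1 / 2 : ℝ) := by
    rw [eLpNorm_eq_lintegral_rpow_enorm_toReal (by norm_num) (by norm_num)]
    simp
  have hm (l : ℕ) : MeasurableSet (annulus p n l) := (isClopen_annulus l).isOpen.measurableSet
  have hlim : Tendsto (fun l => ∫⁻ ξ, ‖((annulus p n l).indicator h - h) ξ‖ₑ ^ (2 : ℝ)) atTop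
      (𝓝 (∫⁻ _ : Fin n → ℚ_[p], 0)) := by
    refine tendsto_lintegral_of_dominated_convergence' (fun ξ => ‖h ξ‖ₑ ^ (2 : ℝ))
      (fun l => ?_) (fun l => ae_of_all _ fun ξ => ?_) ?_ ?_
    · exact ((hh.1.indicator (hm l)).sub hh.1).enorm.pow_const _
    · simp only [Pi.sub_apply]
      by_cases hξ : ξ ∈ annulus p n l
      · simp [hξ]
      · simp [hξ]
    · have h2 := hh.2
      rw [hsq] at h2
      intro htop
      rw [htop] at h2
      simp at h2
    · filter_upwards [ae_tendsto_indicator_annulus hn h] with ξ hξ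
      have h1 := (hξ.sub_const (h ξ)).enorm.ennrpow_const 2
      simpa using h1
  simp only [hsq]
  have := hlim.ennrpow_const (1 / 2 : ℝ)
  simpa using this

end Truncation

/-! ### Membership in the completed space -/

section Membership

variable {p : ℕ} [Fact p.Prime] {n : ℕ}

theorem integrable_psi_mul {g : (Fin n → ℚ_[p]) → ℂ} (hg : Integrable g) (x : Fin n → ℚ_[p]) :
    Integrable fun ξ => psi (x ⬝ᵥ ξ) * g ξ :=
  hg.bdd_mul (c := 1) (continuous_psi_dotProduct x).aestronglyMeasurable
    (ae_of_all _ fun _ => (norm_psi _).le)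

theorem fourierInv_sub {g h : (Fin n → ℚ_[p]) → ℂ} (hg : Integrable g) (hh : Integrable h) :
    fourierInv (g - h) = fourierInv g - fourierInv h := by
  funext x
  simp only [fourierInv, Pi.sub_apply, mul_sub]
  exact integral_sub (integrable_psi_mul hg x) (integrable_psi_mul hh x)

theorem IsSchwartzBruhat.sub {φ χ : (Fin n → ℚ_[p]) → ℂ} (hφ : IsSchwartzBruhat φ)
    (hχ : IsSchwartzBruhat χ) : IsSchwartzBruhat (φ - χ) :=
  ⟨hφ.1.sub hχ.1, hφ.2.sub hχ.2⟩

theorem fourierInv_mem_lizorkin {g : (Fin n → ℚ_[p]) → ℂ} (hg : IsSchwartzBruhat g)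
    (h0 : g 0 = 0) : fourierInv g ∈ lizorkin p n :=
  ⟨hg.fourierInv, by rw [hg.fourier_fourierInv, h0]⟩

/-- A sequence in `Φ` that is Cauchy for every norm `‖ ‖_β` converges in `H̃_∞`. -/
theorem exists_tendsto_of_sobolevNorm {w : Fin n → ℕ} {d : ℕ} (φ : ℕ → lizorkin p n)
    (h : ∀ β : ℕ, ∀ ε > 0, ∃ N, ∀ l ≥ N, ∀ m ≥ N,
      sobolevNorm w d (β : ℝ) ((φ l).1 - (φ m).1) < ε) :
    ∃ x : HTildeInf p w d,
      Tendsto (fun l => ((show LizorkinInf p w d from φ l) : HTildeInf p w d)) atTop (𝓝 x) := by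
  have hc : CauchySeq (fun l => (show LizorkinInf p w d from φ l)) := by
    refine cauchy_iInf_uniformSpace.2 fun β => ?_
    let := sobolevEMetric (p := p) w d (β : ℝ)
    refine (EMetric.cauchySeq_iff (u := φ)).2 fun ε hε => ?_
    obtain ⟨N, hN⟩ := h β ε hε
    exact ⟨N, fun l hl m hm => hN l hl m hm⟩
  exact cauchySeq_tendsto_of_complete
    (hc.map (UniformSpace.Completion.uniformContinuous_coe (LizorkinInf p w d)))

/-- The inverse Fourier transform of a rapidly decreasing function that is locally constant away
from the origin belongs to `H̃_∞`: it is approximated by the inverse Fourier transforms of the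
truncations to annuli. Convergence in `L²` follows from the Plancherel identity for the truncations
and Fatou's lemma. -/
theorem RapidlyDecreasing.memHTildeInf_fourierInv {g : (Fin n → ℚ_[p]) → ℂ}
    (hg : RapidlyDecreasing g) (hn : 0 < n) (hc : ∀ ξ ≠ 0, ∀ᶠ η in 𝓝 ξ, g η = g ξ)
    (w : Fin n → ℕ) (d : ℕ) : MemHTildeInf w d (fourierInv g) := by
  set G : ℕ → (Fin n → ℚ_[p]) → ℂ := fun l => (annulus p n l).indicator g with hG
  have hSB (l : ℕ) : IsSchwartzBruhat (G l) := isSchwartzBruhat_indicator_annulus hc l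
  have hgm : AEStronglyMeasurable g volume :=
    aestronglyMeasurable_of_tendsto_ae atTop
      (fun l => (hSB l).1.continuous.aestronglyMeasurable) (ae_tendsto_indicator_annulus hn g)
  have hgi : Integrable g := hg.integrable hgm
  have hg2 : MemLp g 2 volume := hg.memLp_two hgm
  let φ : ℕ → lizorkin p n := fun l => ⟨fourierInv (G l),
    fourierInv_mem_lizorkin (hSB l) (Set.indicator_of_notMem (zero_notMem_annulus l) _)⟩
  have hsub (l m : ℕ) : (φ l).1 - (φ m).1 = fourierInv (G l - G m) :=
    (fourierInv_sub (hSB l).integrable (hSB m).integrable).symm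
  obtain ⟨x, hx⟩ := exists_tendsto_of_sobolevNorm (w := w) (d := d) φ (by
    intro β ε hε
    set h : (Fin n → ℚ_[p]) → ℂ := fun ξ => ((Xi w d ξ ^ (β : ℝ) : ℝ) : ℂ) * g ξ with hh
    have hwm : AEStronglyMeasurable (fun ξ : Fin n → ℚ_[p] => ((Xi w d ξ ^ (β : ℝ) : ℝ) : ℂ))
        volume := by
      refine Measurable.aestronglyMeasurable ?_
      unfold Xi
      fun_prop
    have hhm : MemLp h 2 volume := (hg.weight_mul w d β).memLp_two (hwm.mul hgm)
    have hlim := tendsto_eLpNorm_indicator_annulus_sub hn hhm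
    obtain ⟨N, hN⟩ := eventually_atTop.1
      (hlim.eventually (gt_mem_nhds (ENNReal.half_pos hε.ne')))
    refine ⟨N, fun l hl m hm => ?_⟩
    have hmeas (l : ℕ) : AEStronglyMeasurable ((annulus p n l).indicator h - h) volume :=
      (hhm.1.indicator (isClopen_annulus l).isOpen.measurableSet).sub hhm.1
    have heq : (fun ξ => ((Xi w d ξ ^ (β : ℝ) : ℝ) : ℂ) * fourier ((φ l).1 - (φ m).1) ξ)
        = ((annulus p n l).indicator h - h) - ((annulus p n m).indicator h - h) := by
      funext ξ
      rw [hsub, ((hSB l).sub (hSB m)).fourier_fourierInv]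
      simp only [hG, Pi.sub_apply, hh, Set.indicator_mul_right]
      ring
    rw [sobolevNorm_eq_eLpNorm, heq]
    calc _ ≤ _ := eLpNorm_sub_le (hmeas l) (hmeas m) (by norm_num)
      _ < ε / 2 + ε / 2 := ENNReal.add_lt_add (hN l hl) (hN m hm)
      _ = ε := ENNReal.add_halves ε)
  have hφm (l : ℕ) : AEStronglyMeasurable (φ l).1 volume :=
    (φ l).2.1.1.continuous.aestronglyMeasurable
  -- The integrands converge only almost everywhere: the truncations vanish at the origin.
  have hpt (y : Fin n → ℚ_[p]) :
      Tendsto (fun l => (φ l).1 y) atTop (𝓝 (fourierInv g y)) := by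
    refine tendsto_integral_of_dominated_convergence (fun ξ => ‖g ξ‖)
      (fun l => (integrable_psi_mul (hSB l).integrable y).1) hgi.norm
      (fun l => ae_of_all _ fun ξ => ?_) ?_
    · rw [norm_mul, norm_psi, one_mul]
      exact norm_indicator_le_norm_self _ _
    · filter_upwards [ae_tendsto_indicator_annulus hn g] with ξ hξ
      exact hξ.const_mul _
  have hum : AEStronglyMeasurable (fourierInv g) volume :=
    aestronglyMeasurable_of_tendsto_ae atTop hφm (ae_of_all _ hpt)
  have hlim := tendsto_eLpNorm_indicator_annulus_sub hn hg2
  have hmeas (l : ℕ) : AEStronglyMeasurable (G l - g) volume :=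
    (hSB l).1.continuous.aestronglyMeasurable.sub hgm
  -- Fatou's lemma for `φ l - φ m` as `m → ∞`, with the Plancherel identity for each `m`.
  have hle (l : ℕ) : eLpNorm ((φ l).1 - fourierInv g) 2 volume ≤ eLpNorm (G l - g) 2 volume := by
    have hF := Lp.eLpNorm_lim_le_liminf_eLpNorm (p := 2) (μ := volume)
      (f := fun m => (φ l).1 - (φ m).1) (fun m => (hφm l).sub (hφm m)) ((φ l).1 - fourierInv g)
      (ae_of_all _ fun y => (hpt y).const_sub _)
    refine hF.trans ?_
    have hb (m : ℕ) : eLpNorm ((φ l).1 - (φ m).1) 2 volume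
        ≤ eLpNorm (G l - g) 2 volume + eLpNorm (G m - g) 2 volume := by
      rw [hsub, ((hSB l).sub (hSB m)).eLpNorm_fourierInv, ← sub_sub_sub_cancel_right (G l) (G m) g]
      exact eLpNorm_sub_le (hmeas l) (hmeas m) (by norm_num)
    have ht := (tendsto_const_nhds (x := eLpNorm (G l - g) 2 volume)).add hlim
    rw [add_zero] at ht
    exact (liminf_le_liminf (Eventually.of_forall hb)).trans_eq ht.liminf_eq
  have hL2 : Tendsto (fun l => eLpNorm ((φ l).1 - fourierInv g) 2 volume) atTop (𝓝 0) :=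
    tendsto_of_tendsto_of_tendsto_of_le_of_le tendsto_const_nhds hlim (fun _ => zero_le) hle
  refine ⟨?_, x, φ, hx, hL2⟩
  have hdiff : MemLp ((φ 0).1 - fourierInv g) 2 volume :=
    ⟨(hφm 0).sub hum, (hle 0).trans_lt ((hSB 0).memLp_two.sub hg2).2⟩
  have := (φ 0).2.1.memLp_two.sub hdiff
  rwa [sub_sub_cancel] at this

end Membership

/-! ### The heat symbol and its truncation -/

section HeatSymbol

variable {p : ℕ} [Fact p.Prime] {n : ℕ} {f : MvPolynomial (Fin n) ℚ_[p]} {w : Fin n → ℕ} {d : ℕ}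

theorem eventually_Omega_eq (l : ℤ) (ξ : Fin n → ℚ_[p]) :
    ∀ᶠ η in 𝓝 ξ, Omega l η = Omega l ξ := by
  by_cases hξ : ξ ∈ Metric.closedBall (0 : Fin n → ℚ_[p]) ((p : ℝ) ^ l)
  · filter_upwards [(isClopen_closedBall_zpow l).isOpen.mem_nhds hξ] with η hη
    rw [mem_closedBall_zero_iff] at hη hξ
    rw [Omega, Omega, if_pos hη, if_pos hξ]
  · filter_upwards [(isClopen_closedBall_zpow l).compl.isOpen.mem_nhds hξ] with η hη
    rw [Set.mem_compl_iff, mem_closedBall_zero_iff] at hη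
    rw [mem_closedBall_zero_iff] at hξ
    rw [Omega, Omega, if_neg hη, if_neg hξ]

theorem IsQuasielliptic.integrable_heatSymbol (hf : IsQuasielliptic f w d) {α t : ℝ} (hα : 0 < α)
    (ht : 0 < t) : Integrable (heatSymbol f α t) := by
  refine (hf.rapidlyDecreasing_heatSymbol hα ht).integrable (Continuous.aestronglyMeasurable ?_)
  exact Complex.continuous_ofReal.comp (Real.continuous_exp.comp (continuous_const.mul
    ((MvPolynomial.continuous_eval f).norm.rpow_const fun _ => Or.inr hα.le)))

end HeatSymbol

end PadicHeat

theorem mainTheorem5 {p : ℕ} [Fact p.Prime] {n : ℕ} (f : MvPolynomial (Fin n) ℚ_[p])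
    (w : Fin n → ℕ) (d : ℕ) (hf : PadicHeat.IsQuasielliptic f w d) (α : ℝ) (hα : 0 < α) :
    (∀ t : ℝ, 0 < t → Integrable (PadicHeat.heatSymbol f α t)) ∧
    (∀ (r : ℕ) (t : ℝ), 1 ≤ r → 0 < t →
      PadicHeat.MemHTildeInf w d (PadicHeat.phi f α r t)) ∧
    (∀ t : ℝ, 0 < t →
      PadicHeat.MemHTildeInf w d (fun x => PadicHeat.heatKernel f α x t)) := by
  refine ⟨fun t ht => hf.integrable_heatSymbol hα ht, fun r t _ ht => ?_, fun t ht => ?_⟩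
  · refine PadicHeat.RapidlyDecreasing.memHTildeInf_fourierInv ?_ hf.dim_pos ?_ w d
    · refine (hf.rapidlyDecreasing_heatSymbol hα ht).mono fun ξ => ?_
      rw [norm_mul]
      refine mul_le_of_le_one_left (norm_nonneg _) ?_
      unfold PadicHeat.Omega
      split_ifs <;> simp
    · intro ξ hξ
      filter_upwards [hf.eventually_heatSymbol_eq α t hξ,
        PadicHeat.eventually_Omega_eq (-(r : ℤ)) ξ] with η h1 h2
      rw [h1, h2]
  · exact (hf.rapidlyDecreasing_heatSymbol hα ht).memHTildeInf_fourierInv hf.dim_pos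
      (fun ξ hξ => hf.eventually_heatSymbol_eq α t hξ) w d
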